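/- Let $\mathcal A$ be an operator algebra, that is, a norm-closed (not necessarily unital or self-adjoint) subalgebra of $B(\mathcal H_0)$ for some complex Hilbert space $\mathcal H_0$, with the matrix norms inherited from the C*-algebras $M_n(B(\mathcal H_0))$. A *representation* of an operator algebra is a completely contractive homomorphism into $B(\mathcal K)$ (or into a C*-algebra). For a subset $S$ of a C*-algebra, let $\mathrm C^*(S)$ be the closed, possibly non-unital, $*$-subalgebra that it generates. Let $(\mathrm C^*_{\max}(\mathcal A),\upsilon)$ be the maximal C*-cover of $\mathcal A$: $\mathrm C^*_{\max}(\mathcal A)$ is a C*-algebra, $\upsilon:\mathcal A\to \mathrm C^*_{\max}(\mathcal A)$ is a completely isometric homomorphism with $\mathrm C^*(\upsilon(\mathcal A))=\mathrm C^*_{\max}(\mathcal A)$, and for every C*-algebra $\mathfrak C$ and every representation $\pi:\mathcal A\to\mathfrak C$ there is a $*$-representation $\widehat\pi:\mathrm C^*_{\max}(\mathcal A)\to\mathfrak C$ with $\widehat\pi\circ\upsilon=\pi$. An operator algebra $\mathcal B$ is *residually finite-dimensional* (RFD) if its representations on finite-dimensional Hilbert spaces are completely norming: for all $n$ and all $x\in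 M_n(\mathcal B)$, $\|x\|$ is the supremum of $\|\pi^{(n)}(x)\|$ over the representations $\pi$ of $\mathcal B$ on finite-dimensional Hilbert spaces. An *Exel–Loring approximation* of a representation $\pi:\mathcal A\to B(\mathcal K)$ is a net of representations $\pi_\lambda:\mathcal A\to B(\mathcal K)$ such that the space $\mathrm C^*(\pi_\lambda(\mathcal A))\mathcal K$ is finite-dimensional for every $\lambda$ and, for every $a\in\mathcal A$, $\pi_\lambda(a)\to\pi(a)$ and $\pi_\lambda(a)^*\to\pi(a)^*$ in the strong operator topology. Then the following statements are equivalent. (i) The C*-algebra $\mathrm C^*_{\max}(\mathcal A)$ is RFD. (ii) Every representation of $\mathcal A$ on a Hilbert space admits an Exel–Loring approximation. (iii) For every Hilbert space $\mathcal K$ and every injective $*$-representation $\rho:\mathrm C^*_{\max}(\mathcal A)\to B(\mathcal K)$ (that is, for every embedding $\mathrm C^*_{\max}(\mathcal A)\subset B(\mathcal K)$), the representation $\rho\circ\upsilon:\mathcal A\to B(\mathcal K)$ admits an Exel–Loring approximation. (iii$'$) There are a Hilbert space $\mathcal K$ and an injective $*$-representation $\rho:\mathrm C^*_{\max}(\mathcal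 A)\to B(\mathcal K)$ such that $\rho\circ\upsilon$ admits an Exel–Loring approximation. -/

import Mathlib

open scoped ENNReal Topology

universe u

/-! ### Matrix norms -/

/-- A choice of a norm on each matrix space `M_n(A)`. The only instances are the two
canonical ones below: for a C⋆-algebra, and for a subalgebra of a C⋆-algebra. -/
class MatrixNormed (A : Type*) where
  /-- The norm on `n × n` matrices over `A`. -/
  mnorm : {n : ℕ} → Matrix (Fin n) (Fin n) A → ℝ

/-- On a C⋆-algebra `B`, the matrix norm is the (unique) C⋆-norm of `M_n(B)`. Mathlib's norm on
`CStarMatrix` needs the order of `B`, for which the canonical (spectral) one is taken. -/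
noncomputable instance MatrixNormed.ofCStarAlgebra (B : Type*) [NonUnitalCStarAlgebra B] :
    MatrixNormed B where
  mnorm {n} x :=
    letI : PartialOrder B := CStarAlgebra.spectralOrder B
    haveI : StarOrderedRing B := CStarAlgebra.spectralOrderedRing B
    ‖(CStarMatrix.ofMatrix x : CStarMatrix (Fin n) (Fin n) B)‖

/-- On a subalgebra `S` of a C⋆-algebra `B`, the matrix norms are those inherited from `B`. -/
noncomputable instance MatrixNormed.ofSubalgebra {B : Type*} [NonUnitalCStarAlgebra B]
    (S : NonUnitalSubalgebra ℂ B) : MatrixNormed S where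
  mnorm {_} x := MatrixNormed.mnorm (x.map (fun s : S => (s : B)))

section Maps

variable {A : Type*} [NonUnitalRing A] [Module ℂ A] [MatrixNormed A]
variable {B : Type*} [NonUnitalRing B] [Module ℂ B] [MatrixNormed B]

/-- Complete contractivity of a homomorphism. A *representation* of an operator algebra is a
completely contractive homomorphism. -/
def IsCompletelyContractive (φ : A →ₙₐ[ℂ] B) : Prop :=
  ∀ (n : ℕ) (x : Matrix (Fin n) (Fin n) A),
    MatrixNormed.mnorm (x.map φ) ≤ MatrixNormed.mnorm x

/-- Complete isometry of a homomorphism. -/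
def IsCompletelyIsometric (φ : A →ₙₐ[ℂ] B) : Prop :=
  ∀ (n : ℕ) (x : Matrix (Fin n) (Fin n) A),
    MatrixNormed.mnorm (x.map φ) = MatrixNormed.mnorm x

end Maps

/-! ### C⋆-covers -/

/-- `C⋆(S)`: the closed (possibly non-unital) ⋆-subalgebra generated by a subset `S` of a
C⋆-algebra. -/
noncomputable def cstarGenerated {B : Type*} [NonUnitalCStarAlgebra B] (S : Set B) :
    NonUnitalStarSubalgebra ℂ B :=
  (NonUnitalStarAlgebra.adjoin ℂ S).topologicalClosure

/-- `(C, ι)` is a C⋆-cover of `A`. -/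
structure IsCStarCover {A C : Type*} [NonUnitalRing A] [Module ℂ A] [MatrixNormed A]
    [NonUnitalCStarAlgebra C] (ι : A →ₙₐ[ℂ] C) : Prop where
  completelyIsometric : IsCompletelyIsometric ι
  generates : cstarGenerated (Set.range ι) = ⊤

/-- `(C, υ)` is the maximal C⋆-cover of `A`: every representation of `A` in a C⋆-algebra extends
to a ⋆-representation of `C`. -/
structure IsMaximalCStarCover {A C : Type u} [NonUnitalRing A] [Module ℂ A] [MatrixNormed A]
    [NonUnitalCStarAlgebra C] (υ : A →ₙₐ[ℂ] C) : Prop extends IsCStarCover υ where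
  universal : ∀ (D : Type u) [NonUnitalCStarAlgebra D] (π : A →ₙₐ[ℂ] D),
    IsCompletelyContractive π → ∃ σ : C →⋆ₙₐ[ℂ] D, ∀ a, σ (υ a) = π a

/-! ### Residual finite-dimensionality and approximations -/

/-- `A` is residually finite-dimensional: the representations of `A` on finite-dimensional Hilbert
spaces are completely norming. -/
def IsRFD (A : Type u) [NonUnitalRing A] [Module ℂ A] [MatrixNormed A] : Prop :=
  ∀ (n : ℕ) (x : Matrix (Fin n) (Fin n) A),
    IsLUB {r : ℝ | ∃ (K : Type u) (_ : NormedAddCommGroup K) (_ : InnerProductSpace ℂ K)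
        (_ : CompleteSpace K) (π : A →ₙₐ[ℂ] (K →L[ℂ] K)),
        FiniteDimensional ℂ K ∧ IsCompletelyContractive π ∧ r = MatrixNormed.mnorm (x.map π)}
      (MatrixNormed.mnorm x)

section ExelLoring

variable {A : Type*} [NonUnitalRing A] [Module ℂ A] [MatrixNormed A]
variable {K : Type*} [NormedAddCommGroup K] [InnerProductSpace ℂ K] [CompleteSpace K]

/-- The subspace `C⋆(π(A)) K` of `K`. -/
noncomputable def essentialSpace (π : A →ₙₐ[ℂ] (K →L[ℂ] K)) : Submodule ℂ K :=
  Submodule.span ℂ {η : K | ∃ T ∈ cstarGenerated (Set.range π), ∃ ξ : K, T ξ = η}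

/-- The net `(σ i)` is an Exel–Loring approximation of `π`. -/
structure IsExelLoringApproximation {Λ : Type*} [Preorder Λ]
    (σ : Λ → A →ₙₐ[ℂ] (K →L[ℂ] K)) (π : A →ₙₐ[ℂ] (K →L[ℂ] K)) : Prop where
  completelyContractive : ∀ i, IsCompletelyContractive (σ i)
  finiteDimensional : ∀ i, FiniteDimensional ℂ (essentialSpace (σ i))
  tendsto : ∀ (a : A) (ξ : K), Filter.Tendsto (fun i => σ i a ξ) Filter.atTop (𝓝 (π a ξ))
  tendsto_adjoint : ∀ (a : A) (ξ : K),
    Filter.Tendsto (fun i => star (σ i a) ξ) Filter.atTop (𝓝 (star (π a) ξ))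

end ExelLoring

/-- `π` admits an Exel–Loring approximation, indexed by some (nonempty) directed set. -/
def AdmitsExelLoringApproximation {A : Type u} [NonUnitalRing A] [Module ℂ A] [MatrixNormed A]
    {K : Type u} [NormedAddCommGroup K] [InnerProductSpace ℂ K] [CompleteSpace K]
    (π : A →ₙₐ[ℂ] (K →L[ℂ] K)) : Prop :=
  ∃ (Λ : Type u) (_ : Preorder Λ) (_ : IsDirectedOrder Λ) (_ : Nonempty Λ)
    (σ : Λ → A →ₙₐ[ℂ] (K →L[ℂ] K)), IsExelLoringApproximation σ π

/-! ### Existence of the maximal C⋆-cover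

The maximal C⋆-cover exists for every operator algebra, so that `IsMaximalCStarCover` is never
a vacuous assumption. -/

section Existence

/-- Formal ⋆-polynomials without constant term in the elements of `A`. -/
inductive StarPoly (A : Type u) : Type u
  | gen (a : A)
  | add (e f : StarPoly A)
  | mul (e f : StarPoly A)
  | smul (c : ℂ) (e : StarPoly A)
  | star (e : StarPoly A)

/-- Evaluation of a formal ⋆-polynomial. -/
noncomputable def StarPoly.eval {A : Type u} {B : Type*} [NonUnitalCStarAlgebra B] (f : A → B) :
    StarPoly A → B
  | .gen a => f a
  | .add e g => e.eval f + g.eval f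
  | .mul e g => e.eval f * g.eval f
  | .smul c e => c • e.eval f
  | .star e => Star.star (e.eval f)

theorem StarPoly.map_eval {A : Type u} {B D : Type*} [NonUnitalCStarAlgebra B]
    [NonUnitalCStarAlgebra D] (f : A → B) (σ : B →⋆ₙₐ[ℂ] D) (e : StarPoly A) :
    σ (e.eval f) = e.eval (fun a => σ (f a)) := by
  induction e with
  | gen a => rfl
  | add e g he hg => simp [StarPoly.eval, he, hg]
  | mul e g he hg => simp [StarPoly.eval, he, hg]
  | smul c e he => simp [StarPoly.eval, he]
  | star e he => simp [StarPoly.eval, he, map_star]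

theorem StarPoly.eval_mem {A : Type u} {B : Type*} [NonUnitalCStarAlgebra B] (f : A → B)
    (e : StarPoly A) : e.eval f ∈ NonUnitalStarAlgebra.adjoin ℂ (Set.range f) := by
  induction e with
  | gen a => exact NonUnitalStarAlgebra.subset_adjoin ℂ _ ⟨a, rfl⟩
  | add e g he hg => exact add_mem he hg
  | mul e g he hg => exact mul_mem he hg
  | smul c e he => exact SMulMemClass.smul_mem c he
  | star e he => exact star_mem he

theorem StarPoly.exists_eval_eq {A : Type u} [NonUnitalRing A] [Module ℂ A] {B : Type*}
    [NonUnitalCStarAlgebra B] (f : A → B) {b : B}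
    (hb : b ∈ NonUnitalStarAlgebra.adjoin ℂ (Set.range f)) : ∃ e : StarPoly A, e.eval f = b := by
  induction hb using NonUnitalStarAlgebra.adjoin_induction with
  | mem x hx => obtain ⟨a, rfl⟩ := hx; exact ⟨.gen a, rfl⟩
  | add x y _ _ hx hy =>
    obtain ⟨e, rfl⟩ := hx; obtain ⟨g, rfl⟩ := hy; exact ⟨.add e g, rfl⟩
  | zero => exact ⟨.smul 0 (.gen 0), by simp [StarPoly.eval]⟩
  | mul x y _ _ hx hy =>
    obtain ⟨e, rfl⟩ := hx; obtain ⟨g, rfl⟩ := hy; exact ⟨.mul e g, rfl⟩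
  | smul r x _ hx => obtain ⟨e, rfl⟩ := hx; exact ⟨.smul r e, rfl⟩
  | star x _ hx => obtain ⟨e, rfl⟩ := hx; exact ⟨.star e, rfl⟩

theorem mem_cstarGenerated_range_iff {A : Type u} [NonUnitalRing A] [Module ℂ A] {B : Type*}
    [NonUnitalCStarAlgebra B] (f : A → B) (b : B) :
    b ∈ cstarGenerated (Set.range f) ↔ b ∈ closure (Set.range (StarPoly.eval f)) := by
  have : (NonUnitalStarAlgebra.adjoin ℂ (Set.range f) : Set B) = Set.range (StarPoly.eval f) := by
    ext x
    exact ⟨fun h => StarPoly.exists_eval_eq f h, by rintro ⟨e, rfl⟩; exact e.eval_mem f⟩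
  rw [← this]
  rfl

theorem mnorm_map_le {B D : Type*} [NonUnitalCStarAlgebra B] [NonUnitalCStarAlgebra D]
    (σ : B →⋆ₙₐ[ℂ] D) {n : ℕ} (x : Matrix (Fin n) (Fin n) B) :
    MatrixNormed.mnorm (x.map σ) ≤ MatrixNormed.mnorm x := by
  let _ : PartialOrder B := CStarAlgebra.spectralOrder B
  have _ : StarOrderedRing B := CStarAlgebra.spectralOrderedRing B
  let _ : PartialOrder D := CStarAlgebra.spectralOrder D
  have _ : StarOrderedRing D := CStarAlgebra.spectralOrderedRing D
  exact NonUnitalStarAlgHom.norm_apply_le (CStarMatrix.mapₙₐ (n := Fin n) σ)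
    (CStarMatrix.ofMatrix x)

theorem norm_entry_le_mnorm {B : Type*} [NonUnitalCStarAlgebra B] {n : ℕ}
    (x : Matrix (Fin n) (Fin n) B) (i j : Fin n) : ‖x i j‖ ≤ MatrixNormed.mnorm x := by
  let _ : PartialOrder B := CStarAlgebra.spectralOrder B
  have _ : StarOrderedRing B := CStarAlgebra.spectralOrderedRing B
  exact CStarMatrix.norm_entry_le_norm (M := CStarMatrix.ofMatrix x) (i := i) (j := j)

/-- Coordinate projections of an `ℓ∞`-product of C⋆-algebras. -/
noncomputable def lpEval {I : Type*} (B : I → Type*) [∀ i, NonUnitalCStarAlgebra (B i)] (i : I) :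
    lp B ∞ →⋆ₙₐ[ℂ] B i where
  toFun f := f i
  map_smul' _ _ := rfl
  map_zero' := rfl
  map_add' _ _ := rfl
  map_mul' _ _ := rfl
  map_star' _ := rfl

theorem mnorm_lp_le {I : Type*} (B : I → Type*) [∀ i, NonUnitalCStarAlgebra (B i)] {n : ℕ}
    (x : Matrix (Fin n) (Fin n) (lp B ∞)) {r : ℝ} (hr : 0 ≤ r)
    (h : ∀ i, MatrixNormed.mnorm (x.map (lpEval B i)) ≤ r) : MatrixNormed.mnorm x ≤ r := by
  let _ : ∀ i, PartialOrder (B i) := fun i => CStarAlgebra.spectralOrder (B i)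
  have _ : ∀ i, StarOrderedRing (B i) := fun i => CStarAlgebra.spectralOrderedRing (B i)
  let _ : PartialOrder (lp B ∞) := CStarAlgebra.spectralOrder _
  have _ : StarOrderedRing (lp B ∞) := CStarAlgebra.spectralOrderedRing _
  let Φ : CStarMatrix (Fin n) (Fin n) (lp B ∞) →⋆ₙₐ[ℂ]
      lp (fun i => CStarMatrix (Fin n) (Fin n) (B i)) ∞ :=
    { toFun := fun M => ⟨fun i => CStarMatrix.mapₙₐ (lpEval B i) M, by
        refine memℓp_infty ⟨‖M‖, ?_⟩
        rintro _ ⟨i, rfl⟩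
        exact NonUnitalStarAlgHom.norm_apply_le (CStarMatrix.mapₙₐ (n := Fin n) (lpEval B i)) M⟩
      map_smul' := fun c M => by ext1; funext i; exact map_smul (CStarMatrix.mapₙₐ (lpEval B i)) c M
      map_zero' := by ext1; funext i; exact map_zero (CStarMatrix.mapₙₐ (n := Fin n) (lpEval B i))
      map_add' := fun M N => by ext1; funext i; exact map_add (CStarMatrix.mapₙₐ (lpEval B i)) M N
      map_mul' := fun M N => by ext1; funext i; exact map_mul (CStarMatrix.mapₙₐ (lpEval B i)) M N
      map_star' := fun M => by ext1; funext i; exact map_star (CStarMatrix.mapₙₐ (lpEval B i)) M }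
  have hΦ : Function.Injective Φ := by
    intro M N hMN
    ext k l p
    have h1 : Φ M p = Φ N p := by rw [hMN]
    exact congrFun (congrFun h1 k) l
  change ‖(CStarMatrix.ofMatrix x : CStarMatrix (Fin n) (Fin n) (lp B ∞))‖ ≤ r
  rw [← NonUnitalStarAlgHom.norm_map Φ hΦ]
  exact lp.norm_le_of_forall_le hr fun i => h i

theorem exists_extension {A : Type u} [NonUnitalRing A] [Module ℂ A] {C D : Type u}
    [NonUnitalCStarAlgebra C] [NonUnitalCStarAlgebra D] (υ : A →ₙₐ[ℂ] C) (π' : A →ₙₐ[ℂ] D)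
    (hdense : ∀ x : C, x ∈ closure (Set.range (StarPoly.eval υ)))
    (hle : ∀ e : StarPoly A, ‖e.eval π'‖ ≤ ‖e.eval υ‖) :
    ∃ σ : C →⋆ₙₐ[ℂ] D, ∀ a, σ (υ a) = π' a := by
  -- The graph of the extension.
  let g : A → C × D := fun a => (υ a, π' a)
  let G : NonUnitalStarSubalgebra ℂ (C × D) := cstarGenerated (Set.range g)
  have hG : IsClosed (G : Set (C × D)) :=
    NonUnitalStarSubalgebra.isClosed_topologicalClosure _
  let _ : NonUnitalCStarAlgebra G :=
    NonUnitalStarSubalgebra.nonUnitalCStarAlgebra (h_closed := hG) G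
  have hgmem : ∀ a, g a ∈ G := fun a =>
    NonUnitalStarSubalgebra.le_topologicalClosure _
      (NonUnitalStarAlgebra.subset_adjoin ℂ _ ⟨a, rfl⟩)
  let p₁ : G →⋆ₙₐ[ℂ] C :=
    (NonUnitalStarAlgHom.fst ℂ C D).comp (NonUnitalStarSubalgebraClass.subtype G)
  let p₂ : G →⋆ₙₐ[ℂ] D :=
    (NonUnitalStarAlgHom.snd ℂ C D).comp (NonUnitalStarSubalgebraClass.subtype G)
  have hnorm : ∀ x ∈ G, ‖x.2‖ ≤ ‖x.1‖ := by
    intro x hx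
    have hx' := (mem_cstarGenerated_range_iff g x).1 hx
    have hcl : IsClosed {x : C × D | ‖x.2‖ ≤ ‖x.1‖} :=
      isClosed_le (by fun_prop) (by fun_prop)
    refine hcl.closure_subset_iff.2 ?_ hx'
    rintro _ ⟨e, rfl⟩
    have e1 : (e.eval g).1 = e.eval υ :=
      StarPoly.map_eval g (NonUnitalStarAlgHom.fst ℂ C D) e
    have e2 : (e.eval g).2 = e.eval π' :=
      StarPoly.map_eval g (NonUnitalStarAlgHom.snd ℂ C D) e
    change ‖(e.eval g).2‖ ≤ ‖(e.eval g).1‖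
    rw [e1, e2]
    exact hle e
  have hinj : Function.Injective p₁ := by
    refine (injective_iff_map_eq_zero p₁).2 fun x hx => ?_
    have h1 : (x : C × D).1 = 0 := hx
    have h2 := hnorm x x.2
    rw [h1, norm_zero, norm_le_zero_iff] at h2
    exact Subtype.ext (Prod.ext h1 h2)
  have hsurj : Function.Surjective p₁ := by
    have hcl : IsClosed (Set.range p₁) :=
      (NonUnitalStarAlgHom.isometry p₁ hinj).isClosedEmbedding.isClosed_range
    intro y
    refine hcl.closure_subset_iff.2 ?_ (hdense y)
    rintro _ ⟨e, rfl⟩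
    refine ⟨e.eval (fun a => (⟨g a, hgmem a⟩ : G)), ?_⟩
    rw [StarPoly.map_eval]
    rfl
  let E : G ≃⋆ₐ[ℂ] C := StarAlgEquiv.ofBijective p₁ ⟨hinj, hsurj⟩
  refine ⟨p₂.comp (E.symm : C →⋆ₙₐ[ℂ] G), fun a => ?_⟩
  have : E.symm (υ a) = ⟨g a, hgmem a⟩ := by
    rw [StarAlgEquiv.symm_apply_eq]
    rfl
  change p₂ (E.symm (υ a)) = π' a
  rw [this]
  rfl

theorem exists_isMaximalCStarCover_of_embedding (A : Type u) [NonUnitalRing A] [Module ℂ A]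
    [MatrixNormed A] {B₀ : Type u} [NonUnitalCStarAlgebra B₀] (j : A →ₙₐ[ℂ] B₀)
    (hj : IsCompletelyIsometric j) :
    ∃ (C : Type u) (_ : NonUnitalCStarAlgebra C) (υ : A →ₙₐ[ℂ] C), IsMaximalCStarCover υ := by
  let S : Set (StarPoly A → ℝ) := {p | ∃ (B : Type u) (_ : NonUnitalCStarAlgebra B)
    (π : A →ₙₐ[ℂ] B), IsCompletelyContractive π ∧ ∀ e, p e = ‖e.eval π‖}
  choose B inst π hπ hp using fun p : S => p.2
  have mnorm_nonneg : ∀ {n : ℕ} (x : Matrix (Fin n) (Fin n) A), 0 ≤ MatrixNormed.mnorm x := by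
    intro n x
    rw [← hj n x]
    let _ : PartialOrder B₀ := CStarAlgebra.spectralOrder B₀
    have _ : StarOrderedRing B₀ := CStarAlgebra.spectralOrderedRing B₀
    exact norm_nonneg (CStarMatrix.ofMatrix (x.map j) : CStarMatrix (Fin n) (Fin n) B₀)
  let υ₀ : A →ₙₐ[ℂ] lp B ∞ :=
    { toFun := fun a => ⟨fun p => π p a, by
        refine memℓp_infty ⟨MatrixNormed.mnorm (fun _ _ : Fin 1 => a), ?_⟩
        rintro _ ⟨p, rfl⟩
        exact (norm_entry_le_mnorm (Matrix.map (fun _ _ : Fin 1 => a) (π p)) 0 0).trans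
          (hπ p 1 _)⟩
      map_smul' := fun c a => by ext1; funext p; exact map_smul (π p) c a
      map_zero' := by ext1; funext p; exact map_zero (π p)
      map_add' := fun a b => by ext1; funext p; exact map_add (π p) a b
      map_mul' := fun a b => by ext1; funext p; exact map_mul (π p) a b }
  let C₀ : NonUnitalStarSubalgebra ℂ (lp B ∞) := cstarGenerated (Set.range υ₀)
  have hC₀ : IsClosed (C₀ : Set (lp B ∞)) :=
    NonUnitalStarSubalgebra.isClosed_topologicalClosure _
  let _ : NonUnitalCStarAlgebra C₀ :=
    NonUnitalStarSubalgebra.nonUnitalCStarAlgebra (h_closed := hC₀) C₀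
  have hmem : ∀ a, υ₀ a ∈ C₀ := fun a =>
    NonUnitalStarSubalgebra.le_topologicalClosure _
      (NonUnitalStarAlgebra.subset_adjoin ℂ _ ⟨a, rfl⟩)
  let υ : A →ₙₐ[ℂ] C₀ := NonUnitalAlgHom.codRestrict υ₀ C₀.toNonUnitalSubalgebra hmem
  let incl : C₀ →⋆ₙₐ[ℂ] lp B ∞ := NonUnitalStarSubalgebraClass.subtype C₀
  have hincl : Function.Injective incl := Subtype.val_injective
  -- The polynomials in `υ` are dense in `C₀`.
  have hdense : ∀ x : C₀, x ∈ closure (Set.range (StarPoly.eval υ)) := by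
    intro x
    rw [closure_subtype]
    have hx : (x : lp B ∞) ∈ closure (Set.range (StarPoly.eval υ₀)) :=
      (mem_cstarGenerated_range_iff υ₀ _).1 x.2
    convert hx using 2
    rw [← Set.range_comp]
    congr 1
    funext e
    exact StarPoly.map_eval υ incl e
  have huniv : ∀ (D : Type u) [NonUnitalCStarAlgebra D] (π' : A →ₙₐ[ℂ] D),
      IsCompletelyContractive π' → ∃ σ : C₀ →⋆ₙₐ[ℂ] D, ∀ a, σ (υ a) = π' a := by
    intro D _ π' hπ'
    have hle : ∀ e : StarPoly A, ‖e.eval π'‖ ≤ ‖e.eval υ‖ := by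
      intro e
      let q : S := ⟨fun e => ‖e.eval π'‖, D, inferInstance, π', hπ', fun _ => rfl⟩
      have h1 : ‖e.eval π'‖ = ‖e.eval (π q)‖ := hp q e
      have h2 : lpEval B q (incl (e.eval υ)) = e.eval (π q) := by
        rw [StarPoly.map_eval, StarPoly.map_eval]; rfl
      rw [h1, ← h2]
      exact (NonUnitalStarAlgHom.norm_apply_le (lpEval B q) _).trans
        (NonUnitalStarAlgHom.norm_apply_le incl _)
    exact exists_extension υ π' hdense hle
  refine ⟨C₀, inferInstance, υ, ⟨⟨fun n x => le_antisymm ?_ ?_, ?_⟩, huniv⟩⟩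
  · have h1 : MatrixNormed.mnorm (x.map υ) = MatrixNormed.mnorm ((x.map υ).map incl) := by
      let _ : PartialOrder C₀ := CStarAlgebra.spectralOrder C₀
      have _ : StarOrderedRing C₀ := CStarAlgebra.spectralOrderedRing C₀
      let _ : PartialOrder (lp B ∞) := CStarAlgebra.spectralOrder _
      have _ : StarOrderedRing (lp B ∞) := CStarAlgebra.spectralOrderedRing _
      refine (NonUnitalStarAlgHom.norm_map (CStarMatrix.mapₙₐ (n := Fin n) incl) ?_
        (CStarMatrix.ofMatrix (x.map υ))).symm
      intro M N hMN
      ext k l : 2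
      exact congrArg Subtype.val (hincl (congrFun (congrFun hMN k) l))
    rw [h1]
    refine mnorm_lp_le B _ (mnorm_nonneg x) fun p => ?_
    exact hπ p n x
  · obtain ⟨σ, hσ⟩ := huniv B₀ j fun n x => (hj n x).le
    rw [← hj n x]
    have h2 : x.map j = (x.map υ).map σ := by
      ext k l
      exact (hσ _).symm
    rw [h2]
    exact mnorm_map_le σ _
  · rw [eq_top_iff]
    intro x _
    exact (mem_cstarGenerated_range_iff υ x).2 (hdense x)

/-- Every operator algebra has a maximal C⋆-cover. -/
theorem exists_isMaximalCStarCover {B : Type u} [NonUnitalCStarAlgebra B]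
    (A : NonUnitalSubalgebra ℂ B) :
    ∃ (C : Type u) (_ : NonUnitalCStarAlgebra C) (υ : A →ₙₐ[ℂ] C), IsMaximalCStarCover υ :=
  exists_isMaximalCStarCover_of_embedding A (NonUnitalSubalgebraClass.subtype A) fun _ _ => rfl

end Existence

/-!
A C⋆-algebra is RFD exactly when its ⋆-representations on finite-dimensional Hilbert spaces separate
points. In one direction, a contractive homomorphism of a C⋆-algebra into the operators of a
finite-dimensional Hilbert space automatically preserves adjoints (`map_star_of_contractive`). In the
other, a separating family embeds the algebra in a product of C⋆-algebras, and embeddings of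
C⋆-algebras preserve all matrix norms.

If `C` has this property, then every ⋆-representation `σ` of `C` on `K` is a point-strong limit of
⋆-representations on `K` with finite-dimensional essential space (`exists_finiteRank_rep_near`, the
theorem of Exel and Loring). Given finitely many elements `a` and vectors `ξ`, the Gram matrix of the
vectors `σ(a)ξ` lies in the closure of the cone of the Gram matrices of the vectors `π(a)η`, for `π`
finite-dimensional (`orbitGram_mem_closure`). Otherwise a separating functional would give a matrix
over `C` whose quadratic form is nonpositive in all finite-dimensional ⋆-representations but not in
`σ`, contrary to the fact that the matrix amplifications of a separating family detect positivity.
When `K` is infinite-dimensional, convergence of Gram matrices can be improved to convergence of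
vectors by isometries into `K` (`exists_linearIsometry_near_of_gram_tendsto`), and conjugating `π` by
such an isometry gives the approximation. This is carried out for the unitization of `C`, so that
degenerate representations need no separate treatment. Since every representation of `A` extends
to the maximal C⋆-cover, restriction to `A` yields Exel–Loring approximations.

Conversely, let an approximation of `ρ ∘ υ` be given, with `ρ` injective. Its terms extend to
⋆-representations of the cover, and these converge strongly to `ρ` on the whole cover, since the
convergence on the generators includes the adjoints. Hence they separate points, and so do their
restrictions to the finite-dimensional essential spaces. Finally, an injective `ρ` exists
by the Gelfand–Naimark theorem (`exists_injective_rep`).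
-/

open scoped InnerProductSpace

/-! ### Contractive homomorphisms into finite-dimensional operator algebras -/

/-- An idempotent contraction of a Hilbert space is an orthogonal projection. -/
theorem isSelfAdjoint_of_isIdempotentElem_of_norm_le_one {K : Type*} [NormedAddCommGroup K]
    [InnerProductSpace ℂ K] [CompleteSpace K] {P : K →L[ℂ] K} (hP : P * P = P) (h1 : ‖P‖ ≤ 1) :
    IsSelfAdjoint P := by
  have key : star P * P = P := by
    ext x
    have hx : P (P x) = P x := congrArg (fun T : K →L[ℂ] K => T x) hP
    -- Equality in Cauchy–Schwarz: `‖P⋆Px‖ ≤ ‖Px‖` and `⟪P⋆Px, Px⟫ = ‖Px‖ ^ 2`.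
    have h2 : ‖star P (P x)‖ ≤ ‖P x‖ := by
      refine ((star P).le_opNorm _).trans ?_
      rw [norm_star]
      exact mul_le_of_le_one_left (norm_nonneg _) h1
    have h3 : ‖star P (P x) - P x‖ ^ 2 ≤ 0 := by
      rw [@norm_sub_sq ℂ, ContinuousLinearMap.star_eq_adjoint,
        ContinuousLinearMap.adjoint_inner_left, hx, inner_self_eq_norm_sq]
      rw [ContinuousLinearMap.star_eq_adjoint] at h2
      nlinarith [norm_nonneg (P x),
        norm_nonneg ((ContinuousLinearMap.adjoint P : K →L[ℂ] K) (P x))]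
    have h4 : ‖star P (P x) - P x‖ = 0 := by
      have := sq_nonneg ‖star P (P x) - P x‖
      exact pow_eq_zero_iff (two_ne_zero) |>.1 (le_antisymm h3 this)
    simpa [sub_eq_zero] using h4
  rw [← key]
  exact IsSelfAdjoint.star_mul_self P

/-- A real number `β` with `-2tβ ≤ t²c` for all real `t` vanishes. -/
theorem eq_zero_of_forall_linear_le_sq {β c : ℝ} (hc : 0 ≤ c)
    (h : ∀ t : ℝ, -(2 * t * β) ≤ t ^ 2 * c) : β = 0 := by
  -- For `β ≠ 0` the inequality fails at this small `t`, of sign opposite to `β`.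
  have h1 := h (-β / (c + 1))
  have h2 : 0 < c + 1 := by linarith
  have h3 : -(2 * (-β / (c + 1)) * β) = 2 * β ^ 2 / (c + 1) := by ring
  have h4 : (-β / (c + 1)) ^ 2 * c = β ^ 2 * c / (c + 1) ^ 2 := by
    rw [div_pow]; ring
  rw [h3, h4, div_le_div_iff₀ h2 (by positivity)] at h1
  have h5 : β ^ 2 * (c + 2) * (c + 1) ≤ 0 := by nlinarith
  have h6 : β ^ 2 ≤ 0 := by
    by_contra h7
    push Not at h7
    have : 0 < β ^ 2 * (c + 2) * (c + 1) := by positivity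
    linarith
  exact pow_eq_zero_iff two_ne_zero |>.1 (le_antisymm h6 (sq_nonneg _))

/-- The C⋆-identity estimate of `e + i t h` for an almost commuting pair, up to second order in `t`. -/
theorem norm_sq_add_I_smul_le {C : Type*} [NonUnitalCStarAlgebra C] {e h : C}
    (he : IsSelfAdjoint e) (hh : IsSelfAdjoint h) (he1 : ‖e‖ ≤ 1) (t : ℝ) :
    ‖e + ((t : ℂ) * Complex.I) • h‖ ^ 2 ≤ 1 + |t| * ‖e * h - h * e‖ + t ^ 2 * ‖h‖ ^ 2 := by
  have h1 : star (e + ((t : ℂ) * Complex.I) • h) * (e + ((t : ℂ) * Complex.I) • h)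
      = e * e + ((t : ℂ) * Complex.I) • (e * h - h * e) + ((t : ℂ) ^ 2) • (h * h) := by
    simp only [star_add, star_smul, he.star_eq, hh.star_eq, add_mul, mul_add, smul_mul_assoc,
      mul_smul_comm, star_mul', RCLike.star_def, Complex.conj_ofReal, Complex.conj_I]
    have : (t : ℂ) ^ 2 = (t : ℂ) * Complex.I * (t * -Complex.I) := by
      linear_combination (t : ℂ) ^ 2 * Complex.I_sq
    rw [this]
    module
  rw [sq, ← CStarRing.norm_star_mul_self, h1]
  refine (norm_add₃_le).trans ?_
  gcongr
  · exact (norm_mul_le _ _).trans (by nlinarith [norm_nonneg e])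
  · rw [norm_smul]; simp
  · rw [norm_smul, sq ‖h‖]
    have := norm_mul_le h h
    simp only [norm_pow, Complex.norm_real, Real.norm_eq_abs, sq_abs]
    gcongr

open Filter in
/-- A contractive homomorphism of a C⋆-algebra into the operators of a finite-dimensional Hilbert
space preserves adjoints. -/
theorem map_star_of_contractive {C K : Type*} [NonUnitalCStarAlgebra C] [NormedAddCommGroup K]
    [InnerProductSpace ℂ K] [CompleteSpace K] [FiniteDimensional ℂ K] (π : C →ₙₐ[ℂ] (K →L[ℂ] K))
    (hπ : ∀ c, ‖π c‖ ≤ ‖c‖) (c : C) : π (star c) = star (π c) := by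
  let _ : PartialOrder C := CStarAlgebra.spectralOrder C
  have _ : StarOrderedRing C := CStarAlgebra.spectralOrderedRing C
  have hcont : Continuous π := by
    refine AddMonoidHomClass.continuous_of_bound π 1 fun x => ?_
    simpa using hπ x
  have hau := CStarAlgebra.increasingApproximateUnit C
  have hne : (CStarAlgebra.approximateUnit C).NeBot := hau.neBot
  let l : Ultrafilter C := Ultrafilter.of (CStarAlgebra.approximateUnit C)
  have hl : (l : Filter C) ≤ CStarAlgebra.approximateUnit C := Ultrafilter.of_le _
  have hl1 : ∀ᶠ e in (l : Filter C), ‖e‖ ≤ 1 := hl hau.eventually_norm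
  have hl2 : ∀ᶠ e in (l : Filter C), IsSelfAdjoint e := hl hau.eventually_isSelfAdjoint
  -- The limit of the images of an approximate unit is the projection onto the essential subspace.
  obtain ⟨P, hP1, hP⟩ : ∃ P ∈ Metric.closedBall (0 : K →L[ℂ] K) 1,
      Tendsto π (l : Filter C) (𝓝 P) := by
    have : ProperSpace (K →L[ℂ] K) := FiniteDimensional.proper ℂ _
    refine (isCompact_closedBall (0 : K →L[ℂ] K) 1).ultrafilter_le_nhds' (l.map π) ?_
    refine Ultrafilter.mem_map.2 ?_
    filter_upwards [hl1] with e he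
    simpa using (hπ e).trans he
  have hPl : ∀ c, P * π c = π c := fun c => by
    refine tendsto_nhds_unique (hP.mul_const (π c)) ?_
    simp only [← map_mul]
    exact (hcont.tendsto _).comp ((hau.tendsto_mul_right c).mono_left hl)
  have hPr : ∀ c, π c * P = π c := fun c => by
    refine tendsto_nhds_unique (hP.const_mul (π c)) ?_
    simp only [← map_mul]
    exact (hcont.tendsto _).comp ((hau.tendsto_mul_left c).mono_left hl)
  have hPP : P * P = P := by
    refine tendsto_nhds_unique (hP.const_mul P) ?_
    simpa only [hPl] using hP
  have hPsa := isSelfAdjoint_of_isIdempotentElem_of_norm_le_one hPP (by simpa using hP1)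
  -- The numerical range of the image of a self-adjoint element is real.
  have hsa : ∀ h : C, IsSelfAdjoint h → IsSelfAdjoint (π h) := by
    intro h hh
    rw [ContinuousLinearMap.isSelfAdjoint_iff_isSymmetric,
      LinearMap.isSymmetric_iff_inner_map_self_real]
    intro ξ
    let v := P ξ
    have hPv : P v = v := congrArg (fun T : K →L[ℂ] K => T ξ) hPP
    have hv : ⟪π h ξ, ξ⟫_ℂ = ⟪π h v, v⟫_ℂ := by
      have h1 : π h ξ = P (π h v) := by
        have : π h = P * (π h * P) := by rw [hPr, hPl]
        exact congrArg (fun T : K →L[ℂ] K => T ξ) this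
      rw [h1]
      conv_lhs => rw [← hPsa.star_eq]
      rw [ContinuousLinearMap.star_eq_adjoint, ContinuousLinearMap.adjoint_inner_left]
    have hbound : ∀ t : ℝ, ‖v + ((t : ℂ) * Complex.I) • π h v‖ ^ 2
        ≤ (1 + t ^ 2 * ‖h‖ ^ 2) * ‖v‖ ^ 2 := by
      intro t
      have hcomm : Tendsto (fun e => ‖e * h - h * e‖) (l : Filter C) (𝓝 0) := by
        have := ((hau.tendsto_mul_right h).sub (hau.tendsto_mul_left h)).mono_left hl
        simpa using this.norm
      have hlhs : Tendsto (fun e => ‖π e v + ((t : ℂ) * Complex.I) • π h v‖ ^ 2) (l : Filter C)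
          (𝓝 (‖v + ((t : ℂ) * Complex.I) • π h v‖ ^ 2)) := by
        have h1 : Tendsto (fun e => π e v) (l : Filter C) (𝓝 (P v)) :=
          ((ContinuousLinearMap.apply ℂ K v).continuous.tendsto P).comp hP
        rw [hPv] at h1
        exact ((h1.add_const _).norm).pow 2
      have hrhs : Tendsto (fun e => (1 + |t| * ‖e * h - h * e‖ + t ^ 2 * ‖h‖ ^ 2) * ‖v‖ ^ 2)
          (l : Filter C) (𝓝 ((1 + t ^ 2 * ‖h‖ ^ 2) * ‖v‖ ^ 2)) := by
        have := (((hcomm.const_mul |t|).const_add 1).add_const (t ^ 2 * ‖h‖ ^ 2)).mul_const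
          (‖v‖ ^ 2)
        simpa using this
      refine le_of_tendsto_of_tendsto hlhs hrhs ?_
      filter_upwards [hl1, hl2] with e he1 he2
      have h1 : π e v + ((t : ℂ) * Complex.I) • π h v
          = π (e + ((t : ℂ) * Complex.I) • h) v := by simp
      rw [h1]
      calc ‖π (e + ((t : ℂ) * Complex.I) • h) v‖ ^ 2
          ≤ (‖e + ((t : ℂ) * Complex.I) • h‖ * ‖v‖) ^ 2 := by
            gcongr
            exact (ContinuousLinearMap.le_opNorm _ _).trans (by gcongr; exact hπ _)
        _ ≤ _ := by
            rw [mul_pow]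
            gcongr
            exact norm_sq_add_I_smul_le he2 hh he1 t
    have him : (⟪v, π h v⟫_ℂ).im = 0 := by
      refine eq_zero_of_forall_linear_le_sq (c := ‖h‖ ^ 2 * ‖v‖ ^ 2) (by positivity) fun t => ?_
      have h1 := hbound t
      rw [@norm_add_sq ℂ, inner_smul_right] at h1
      have h2 : RCLike.re ((t : ℂ) * Complex.I * ⟪v, π h v⟫_ℂ) = -(t * (⟪v, π h v⟫_ℂ).im) := by
        simp
      rw [h2] at h1
      nlinarith [sq_nonneg ‖((t : ℂ) * Complex.I) • π h v‖]
    change (starRingEnd ℂ) ⟪π h ξ, ξ⟫_ℂ = ⟪π h ξ, ξ⟫_ℂ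
    rw [hv, inner_conj_symm, ← inner_conj_symm (π h v) v, Complex.ext_iff]
    simp only [Complex.conj_re, Complex.conj_im, him]
    simp
  have h1 : c = (realPart c : C) + Complex.I • (imaginaryPart c : C) :=
    (realPart_add_I_smul_imaginaryPart c).symm
  have h2 := hsa _ (realPart c).2
  have h3 := hsa _ (imaginaryPart c).2
  rw [h1]
  simp only [star_add, star_smul, map_add, map_smul]
  rw [h2.star_eq, h3.star_eq, (realPart c).2.star_eq, (imaginaryPart c).2.star_eq]

/-! ### Residual finite-dimensionality -/

theorem mnorm_nonneg_of_cstar {B : Type*} [NonUnitalCStarAlgebra B] {n : ℕ}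
    (x : Matrix (Fin n) (Fin n) B) : 0 ≤ MatrixNormed.mnorm x := by
  let _ : PartialOrder B := CStarAlgebra.spectralOrder B
  have _ : StarOrderedRing B := CStarAlgebra.spectralOrderedRing B
  exact norm_nonneg (CStarMatrix.ofMatrix x : CStarMatrix (Fin n) (Fin n) B)

theorem mnorm_one_by_one_le {B : Type*} [NonUnitalCStarAlgebra B] (b : B) :
    MatrixNormed.mnorm (fun _ _ : Fin 1 => b) ≤ ‖b‖ := by
  let _ : PartialOrder B := CStarAlgebra.spectralOrder B
  have _ : StarOrderedRing B := CStarAlgebra.spectralOrderedRing B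
  let E : B →⋆ₙₐ[ℂ] CStarMatrix (Fin 1) (Fin 1) B :=
    { toFun := fun b => CStarMatrix.ofMatrix fun _ _ => b
      map_smul' := fun _ _ => rfl
      map_zero' := rfl
      map_add' := fun _ _ => rfl
      map_mul' := fun a b => by
        ext i j
        rw [CStarMatrix.mul_apply, Fin.sum_univ_one]
        rfl
      map_star' := fun _ => rfl }
  exact NonUnitalStarAlgHom.norm_apply_le E b

theorem norm_apply_le_of_isCompletelyContractive {B D : Type*} [NonUnitalCStarAlgebra B]
    [NonUnitalCStarAlgebra D] {φ : B →ₙₐ[ℂ] D} (hφ : IsCompletelyContractive φ) (b : B) :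
    ‖φ b‖ ≤ ‖b‖ :=
  (norm_entry_le_mnorm (Matrix.map (fun _ _ : Fin 1 => b) φ) 0 0).trans
    ((hφ 1 _).trans (mnorm_one_by_one_le b))

theorem mnorm_map_of_injective {B D : Type*} [NonUnitalCStarAlgebra B] [NonUnitalCStarAlgebra D]
    (σ : B →⋆ₙₐ[ℂ] D) (hσ : Function.Injective σ) {n : ℕ} (x : Matrix (Fin n) (Fin n) B) :
    MatrixNormed.mnorm (x.map σ) = MatrixNormed.mnorm x := by
  let _ : PartialOrder B := CStarAlgebra.spectralOrder B
  have _ : StarOrderedRing B := CStarAlgebra.spectralOrderedRing B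
  let _ : PartialOrder D := CStarAlgebra.spectralOrder D
  have _ : StarOrderedRing D := CStarAlgebra.spectralOrderedRing D
  refine NonUnitalStarAlgHom.norm_map (CStarMatrix.mapₙₐ (n := Fin n) σ) ?_ (CStarMatrix.ofMatrix x)
  intro M N hMN
  ext k l
  exact hσ (congrFun (congrFun hMN k) l)

/-- The ⋆-representations on finite-dimensional Hilbert spaces separate the points of `C`. -/
def HasSeparatingFinDimReps (C : Type u) [NonUnitalCStarAlgebra C] : Prop :=
  ∀ c : C, c ≠ 0 → ∃ (K : Type u) (_ : NormedAddCommGroup K) (_ : InnerProductSpace ℂ K)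
    (_ : CompleteSpace K) (_ : FiniteDimensional ℂ K) (π : C →⋆ₙₐ[ℂ] (K →L[ℂ] K)), π c ≠ 0

theorem IsRFD.hasSeparatingFinDimReps {C : Type u} [NonUnitalCStarAlgebra C] (hC : IsRFD C) :
    HasSeparatingFinDimReps C := by
  intro c hc
  by_contra! hcon
  have hlub := hC 1 (fun _ _ => c)
  have h0 : MatrixNormed.mnorm (fun _ _ : Fin 1 => c) ≤ 0 := by
    refine hlub.2 ?_
    rintro r ⟨K, _, _, _, π, _, hπ, rfl⟩
    let π' : C →⋆ₙₐ[ℂ] (K →L[ℂ] K) :=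
      { π with map_star' := map_star_of_contractive π (norm_apply_le_of_isCompletelyContractive hπ) }
    have h1 : π c = 0 := hcon K _ _ _ ‹_› π'
    have h2 : Matrix.map (fun _ _ : Fin 1 => c) π = fun _ _ : Fin 1 => (0 : K →L[ℂ] K) := by
      ext1 i j; exact h1
    rw [h2]
    simpa using mnorm_one_by_one_le (0 : K →L[ℂ] K)
  have h1 := norm_entry_le_mnorm (fun _ _ : Fin 1 => c) 0 0
  exact hc (norm_le_zero_iff.1 (h1.trans h0))

theorem mnorm_map_le_of_upperBound {C : Type u} [NonUnitalCStarAlgebra C] {n : ℕ}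
    {x : Matrix (Fin n) (Fin n) C} {r : ℝ}
    (hr : r ∈ upperBounds {r : ℝ | ∃ (K : Type u) (_ : NormedAddCommGroup K)
      (_ : InnerProductSpace ℂ K) (_ : CompleteSpace K) (π : C →ₙₐ[ℂ] (K →L[ℂ] K)),
      FiniteDimensional ℂ K ∧ IsCompletelyContractive π ∧ r = MatrixNormed.mnorm (x.map π)})
    {K : Type u} [i1 : NormedAddCommGroup K] [i2 : InnerProductSpace ℂ K] [i3 : CompleteSpace K]
    [i4 : FiniteDimensional ℂ K] (π : C →⋆ₙₐ[ℂ] (K →L[ℂ] K)) :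
    MatrixNormed.mnorm (x.map π) ≤ r :=
  hr ⟨K, i1, i2, i3, (π : C →ₙₐ[ℂ] (K →L[ℂ] K)), i4, fun _ y => mnorm_map_le π y, rfl⟩

/-- A separating family of ⋆-representations embeds `C` in a product of C⋆-algebras, and an
embedding of C⋆-algebras preserves all matrix norms. -/
theorem HasSeparatingFinDimReps.isRFD {C : Type u} [NonUnitalCStarAlgebra C]
    (hC : HasSeparatingFinDimReps C) : IsRFD C := by
  intro n x
  refine ⟨?_, fun r hr => ?_⟩
  · rintro r ⟨K, _, _, _, π, _, hπ, rfl⟩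
    exact hπ n x
  have hr0 : 0 ≤ r := by
    -- The zero representation on a line shows that the set of values is nonempty.
    let π₀ : C →⋆ₙₐ[ℂ] (EuclideanSpace ℂ PUnit.{u + 1} →L[ℂ] EuclideanSpace ℂ PUnit.{u + 1}) := 0
    exact (mnorm_nonneg_of_cstar _).trans (mnorm_map_le_of_upperBound hr π₀)
  choose K i1 i2 i3 i4 π hπ using fun c : {c : C // c ≠ 0} => hC c c.2
  let Φ : C →⋆ₙₐ[ℂ] lp (fun c => K c →L[ℂ] K c) ∞ :=
    { toFun := fun c => ⟨fun i => π i c, by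
        refine memℓp_infty ⟨‖c‖, ?_⟩
        rintro _ ⟨i, rfl⟩
        exact NonUnitalStarAlgHom.norm_apply_le (π i) c⟩
      map_smul' := fun a c => by ext1; funext i; exact map_smul (π i) a c
      map_zero' := by ext1; funext i; exact map_zero (π i)
      map_add' := fun a b => by ext1; funext i; exact map_add (π i) a b
      map_mul' := fun a b => by ext1; funext i; exact map_mul (π i) a b
      map_star' := fun a => by ext1; funext i; exact map_star (π i) a }
  have hΦ : Function.Injective Φ := by
    refine (injective_iff_map_eq_zero Φ).2 fun c hc => ?_
    by_contra hne
    refine hπ ⟨c, hne⟩ ?_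
    have := congrArg (lpEval (fun c => K c →L[ℂ] K c) ⟨c, hne⟩) hc
    rwa [map_zero] at this
  rw [← mnorm_map_of_injective Φ hΦ]
  exact mnorm_lp_le _ _ hr0 fun i => mnorm_map_le_of_upperBound hr (π i)

/-! ### Faithful representations -/

/-- The direct sum of a family of ⋆-representations, on the `ℓ²`-sum of the Hilbert spaces. -/
noncomputable def directSumRep {C : Type*} [NonUnitalCStarAlgebra C] {I : Type*} {K : I → Type*}
    [∀ i, NormedAddCommGroup (K i)] [∀ i, InnerProductSpace ℂ (K i)] [∀ i, CompleteSpace (K i)]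
    (π : ∀ i, C →⋆ₙₐ[ℂ] (K i →L[ℂ] K i)) : C →⋆ₙₐ[ℂ] (lp K 2 →L[ℂ] lp K 2) where
  toFun c := lp.mapCLM 2 (fun i => π i c) (norm_nonneg c)
    fun i => NonUnitalStarAlgHom.norm_apply_le (π i) c
  map_smul' a c := by ext x i; simp
  map_zero' := by ext x i; simp
  map_add' a b := by ext x i; simp
  map_mul' a b := by ext x i; simp
  map_star' a := by
    rw [ContinuousLinearMap.star_eq_adjoint, ContinuousLinearMap.eq_adjoint_iff]
    intro x y
    rw [lp.inner_eq_tsum, lp.inner_eq_tsum]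
    refine tsum_congr fun i => ?_
    simp only [lp.mapCLM_apply_coe, map_star]
    rw [ContinuousLinearMap.star_eq_adjoint, ContinuousLinearMap.adjoint_inner_left]

@[simp]
theorem directSumRep_apply_apply {C : Type*} [NonUnitalCStarAlgebra C] {I : Type*} {K : I → Type*}
    [∀ i, NormedAddCommGroup (K i)] [∀ i, InnerProductSpace ℂ (K i)] [∀ i, CompleteSpace (K i)]
    (π : ∀ i, C →⋆ₙₐ[ℂ] (K i →L[ℂ] K i)) (c : C) (x : lp K 2) (i : I) :
    directSumRep π c x i = π i c (x i) :=
  rfl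

section PositiveFunctionals

open scoped ComplexOrder

/-- A nonzero positive element is detected by a positive functional, since the cone of positive
elements is closed and salient. -/
theorem exists_positiveLinearMap_ne_zero {C : Type*} [NonUnitalCStarAlgebra C] [PartialOrder C]
    [StarOrderedRing C] {z : C} (hz : 0 ≤ z) (hz0 : z ≠ 0) : ∃ f : C →ₚ[ℂ] ℂ, f z ≠ 0 := by
  let P : ProperCone ℝ C :=
    { carrier := {a | 0 ≤ a}
      add_mem' := fun ha hb => add_nonneg ha hb
      zero_mem' := le_rfl
      smul_mem' := fun r a ha => smul_nonneg r.2 ha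
      isClosed' := CStarAlgebra.isClosed_nonneg }
  have hzP : -z ∉ P := fun h => hz0 (le_antisymm (neg_nonneg.1 h) hz)
  obtain ⟨f, hf, hfz⟩ := P.hyperplane_separation_point hzP
  -- Symmetrising `f` makes its complexification real on self-adjoint elements.
  let g : C →ₗ[ℝ] ℝ := f.toLinearMap ∘ₗ (selfAdjoint.submodule ℝ C).subtype ∘ₗ realPart
  let F : C →ₗ[ℂ] ℂ :=
    { toFun := fun a => (g a : ℂ) - Complex.I * (g (Complex.I • a) : ℂ)
      map_add' := fun a b => by simp only [smul_add, map_add]; push_cast; ring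
      map_smul' := fun c a => by
        have h1 : c • a = c.re • a + c.im • (Complex.I • a) := by
          conv_lhs => rw [← Complex.re_add_im c]
          rw [add_smul, mul_smul, Complex.coe_smul, Complex.coe_smul]
        have h2 : Complex.I • (c • a) = c.re • (Complex.I • a) - c.im • a := by
          rw [h1, smul_add, smul_comm Complex.I c.re, smul_comm Complex.I c.im, smul_smul,
            Complex.I_mul_I, neg_one_smul, smul_neg, sub_eq_add_neg]
        rw [h2, h1]
        simp only [map_add, map_sub, map_smul, smul_eq_mul, RingHom.id_apply]
        apply Complex.ext
        · simp
        · simp; ring }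
  have hF : ∀ a, IsSelfAdjoint a → F a = (f a : ℂ) := by
    intro a ha
    have h1 : (realPart a : C) = a := ha.coe_realPart
    have h2 : (realPart (Complex.I • a) : C) = 0 := by
      rw [realPart_I_smul, ha.imaginaryPart]; simp
    change ((f (realPart a : C) : ℝ) : ℂ) - Complex.I * ((f (realPart (Complex.I • a) : C) : ℝ) : ℂ)
      = (f a : ℂ)
    rw [h1, h2]; simp
  refine ⟨PositiveLinearMap.mk₀ F fun a ha => ?_, ?_⟩
  · rw [hF a ha.isSelfAdjoint]
    exact_mod_cast hf a ha
  · change F z ≠ 0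
    rw [hF z hz.isSelfAdjoint]
    rw [map_neg] at hfz
    exact_mod_cast (by linarith : f z ≠ 0)

/-- A nonzero element survives in the GNS representation of a suitable positive functional. -/
theorem exists_rep_apply_ne_zero {C : Type u} [NonUnitalCStarAlgebra C] {c : C} (hc : c ≠ 0) :
    ∃ (K : Type u) (_ : NormedAddCommGroup K) (_ : InnerProductSpace ℂ K) (_ : CompleteSpace K)
      (π : C →⋆ₙₐ[ℂ] (K →L[ℂ] K)), π c ≠ 0 := by
  let _ : PartialOrder C := CStarAlgebra.spectralOrder C
  have _ : StarOrderedRing C := CStarAlgebra.spectralOrderedRing C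
  -- Without a unit, `c` is applied to the vector of `star c` in place of a cyclic vector.
  let z : C := star (c * star c) * (c * star c)
  have hz : z ≠ 0 := by
    rw [CStarRing.star_mul_self_ne_zero_iff, CStarRing.mul_star_self_ne_zero_iff]
    exact hc
  obtain ⟨f, hf⟩ := exists_positiveLinearMap_ne_zero (star_mul_self_nonneg (c * star c)) hz
  refine ⟨f.GNS, inferInstance, inferInstance, inferInstance, f.gnsNonUnitalStarAlgHom, ?_⟩
  intro h0
  have h1 : f.gnsNonUnitalStarAlgHom c (f.toPreGNS (star c) : f.GNS) = 0 := by rw [h0]; rfl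
  rw [PositiveLinearMap.gnsNonUnitalStarAlgHom_apply_coe,
    PositiveLinearMap.leftMulMapPreGNS_apply] at h1
  have h2 : ‖(f.toPreGNS (c * star c) : f.GNS)‖ = 0 := by
    rw [norm_eq_zero]; exact h1
  rw [UniformSpace.Completion.norm_coe] at h2
  have h3 := f.preGNS_norm_sq (f.toPreGNS (c * star c))
  rw [h2] at h3
  refine hf ?_
  simpa using h3.symm

end PositiveFunctionals

/-- Every C⋆-algebra has a faithful ⋆-representation on a Hilbert space. -/
theorem exists_injective_rep (C : Type u) [NonUnitalCStarAlgebra C] :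
    ∃ (K : Type u) (_ : NormedAddCommGroup K) (_ : InnerProductSpace ℂ K) (_ : CompleteSpace K)
      (ρ : C →⋆ₙₐ[ℂ] (K →L[ℂ] K)), Function.Injective ρ := by
  choose K i1 i2 i3 π hπ using fun c : {c : C // c ≠ 0} => exists_rep_apply_ne_zero c.2
  refine ⟨lp K 2, inferInstance, inferInstance, inferInstance, directSumRep π, ?_⟩
  refine (injective_iff_map_eq_zero _).2 fun c hc => ?_
  classical
  by_contra hne
  refine hπ ⟨c, hne⟩ ?_
  ext ξ
  have h1 := congrArg (fun T => T (lp.single 2 ⟨c, hne⟩ ξ) ⟨c, hne⟩) hc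
  simpa using h1

/-! ### Matrix amplifications and positivity -/

/-- The action of an operator matrix on `K^n`. -/
noncomputable def blockOperator {K : Type*} [NormedAddCommGroup K] [InnerProductSpace ℂ K]
    {n : Type*} [Fintype n] (T : n → n → K →L[ℂ] K) :
    PiLp 2 (fun _ : n => K) →L[ℂ] PiLp 2 (fun _ : n => K) :=
  (PiLp.continuousLinearEquiv 2 ℂ (fun _ : n => K)).symm.toContinuousLinearMap ∘L
    ContinuousLinearMap.pi fun i => ∑ j, T i j ∘L PiLp.proj 2 (fun _ : n => K) j

theorem blockOperator_apply {K : Type*} [NormedAddCommGroup K] [InnerProductSpace ℂ K]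
    {n : Type*} [Fintype n] (T : n → n → K →L[ℂ] K) (η : PiLp 2 (fun _ : n => K)) (i : n) :
    blockOperator T η i = ∑ j, T i j (η j) := by
  simp [blockOperator]

/-- The amplification of a ⋆-representation `π` on `K` to a ⋆-representation of the matrix
algebra on `K^n`. -/
noncomputable def amplification {D : Type*} [NonUnitalCStarAlgebra D] {K : Type*}
    [NormedAddCommGroup K] [InnerProductSpace ℂ K] [CompleteSpace K] {n : Type*} [Fintype n]
    (π : D →⋆ₙₐ[ℂ] (K →L[ℂ] K)) :
    CStarMatrix n n D →⋆ₙₐ[ℂ] (PiLp 2 (fun _ : n => K) →L[ℂ] PiLp 2 (fun _ : n => K)) where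
  toFun x := blockOperator fun i j => π (x i j)
  map_smul' a x := by ext η i; simp [blockOperator_apply, Finset.smul_sum]
  map_zero' := by ext η i; simp [blockOperator_apply]
  map_add' x y := by ext η i; simp [blockOperator_apply, Finset.sum_add_distrib]
  map_mul' x y := by
    ext η i
    simp only [blockOperator_apply, CStarMatrix.mul_apply, map_sum, map_mul,
      _root_.sum_apply]
    simp only [ContinuousLinearMap.mul_def, ContinuousLinearMap.comp_apply, blockOperator_apply,
      map_sum]
    exact Finset.sum_comm
  map_star' x := by
    rw [ContinuousLinearMap.star_eq_adjoint, ContinuousLinearMap.eq_adjoint_iff]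
    intro η ζ
    simp only [PiLp.inner_apply, blockOperator_apply, CStarMatrix.star_apply, map_star, sum_inner,
      inner_sum, ContinuousLinearMap.star_eq_adjoint, ContinuousLinearMap.adjoint_inner_left]
    exact Finset.sum_comm

theorem amplification_apply {D : Type*} [NonUnitalCStarAlgebra D] {K : Type*}
    [NormedAddCommGroup K] [InnerProductSpace ℂ K] [CompleteSpace K] {n : Type*} [Fintype n]
    (π : D →⋆ₙₐ[ℂ] (K →L[ℂ] K)) (x : CStarMatrix n n D) (η : PiLp 2 (fun _ : n => K)) (i : n) :
    amplification π x η i = ∑ j, π (x i j) (η j) :=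
  blockOperator_apply _ _ _

/-- Positivity of a self-adjoint element is detected by the vanishing of its negative part, and
⋆-homomorphisms respect negative parts. -/
theorem negPart_map_eq_zero {M B : Type*} [NonUnitalCStarAlgebra M] [NonUnitalCStarAlgebra B]
    [PartialOrder B] [StarOrderedRing B] (Ψ : M →⋆ₙₐ[ℂ] B) {y : M} (hy : IsSelfAdjoint y)
    (h : 0 ≤ Ψ y) : Ψ y⁻ = 0 := by
  have hΨ : Continuous Ψ :=
    AddMonoidHomClass.continuous_of_bound Ψ 1 fun x => by
      simpa using NonUnitalStarAlgHom.norm_apply_le Ψ x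
  have h1 : Ψ y⁻ = (Ψ y)⁻ := by
    rw [CFC.negPart_def, CFC.negPart_def]
    exact NonUnitalStarAlgHom.map_cfcₙ Ψ _ y (hφ := hΨ) (hφa := hy.map Ψ)
  rw [h1, CFC.negPart_eq_zero_iff _ (hy.map Ψ)]
  exact h

theorem re_inner_neg_add_star {M L : Type*} [NonUnitalCStarAlgebra M] [NormedAddCommGroup L]
    [InnerProductSpace ℂ L] [CompleteSpace L] (Ψ : M →⋆ₙₐ[ℂ] (L →L[ℂ] L)) (X : M) (η : L) :
    (⟪η, Ψ (-(X + star X)) η⟫_ℂ).re = -2 * (⟪η, Ψ X η⟫_ℂ).re := by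
  have h2 : ⟪η, Ψ (-(X + star X)) η⟫_ℂ = -(⟪η, Ψ X η⟫_ℂ + ⟪Ψ X η, η⟫_ℂ) := by
    rw [map_neg, map_add, map_star, ContinuousLinearMap.star_eq_adjoint, _root_.neg_apply,
      _root_.add_apply, inner_neg_right, inner_add_right, ContinuousLinearMap.adjoint_inner_right]
  rw [h2, ← inner_conj_symm (Ψ X η) η]
  simp only [Complex.neg_re, Complex.add_re, Complex.conj_re]
  ring

/-- If the real part of `X` is negative in a separating family of ⋆-representations, then it is
negative in every ⋆-representation. -/
theorem re_inner_nonpos_of_separating {M : Type u} [NonUnitalCStarAlgebra M] (X : M)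
    (hX : ∀ z : M, z ≠ 0 → ∃ (L : Type u) (_ : NormedAddCommGroup L) (_ : InnerProductSpace ℂ L)
      (_ : CompleteSpace L) (Ψ : M →⋆ₙₐ[ℂ] (L →L[ℂ] L)), Ψ z ≠ 0 ∧ ∀ η, (⟪η, Ψ X η⟫_ℂ).re ≤ 0)
    {K : Type*} [NormedAddCommGroup K] [InnerProductSpace ℂ K] [CompleteSpace K]
    (Φ : M →⋆ₙₐ[ℂ] (K →L[ℂ] K)) (ξ : K) : (⟪ξ, Φ X ξ⟫_ℂ).re ≤ 0 := by
  let _ : PartialOrder M := CStarAlgebra.spectralOrder M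
  have _ : StarOrderedRing M := CStarAlgebra.spectralOrderedRing M
  let y : M := -(X + star X)
  have hy : IsSelfAdjoint y := (IsSelfAdjoint.add_star_self X).neg
  have hneg : y⁻ = 0 := by
    by_contra hne
    obtain ⟨L, _, _, _, Ψ, hΨ, hL⟩ := hX _ hne
    refine hΨ (negPart_map_eq_zero _ hy ?_)
    rw [ContinuousLinearMap.nonneg_iff_isPositive]
    refine ⟨(ContinuousLinearMap.isSelfAdjoint_iff_isSymmetric.1 (hy.map _)), fun η => ?_⟩
    rw [ContinuousLinearMap.reApplyInnerSelf_apply, inner_re_symm]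
    change 0 ≤ (⟪η, Ψ y η⟫_ℂ).re
    linarith [re_inner_neg_add_star Ψ X η, hL η]
  have hy0 : 0 ≤ y := (CFC.negPart_eq_zero_iff y hy).1 hneg
  have h1 : 0 ≤ Φ y := map_nonneg Φ hy0
  rw [ContinuousLinearMap.nonneg_iff_isPositive] at h1
  have h2 := h1.2 ξ
  rw [ContinuousLinearMap.reApplyInnerSelf_apply, inner_re_symm] at h2
  change 0 ≤ (⟪ξ, Φ y ξ⟫_ℂ).re at h2
  linarith [re_inner_neg_add_star Φ X ξ]

/-- An inequality between quadratic forms with coefficients in `D` which holds in all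
finite-dimensional ⋆-representations persists in every ⋆-representation. -/
theorem re_sum_inner_nonpos {D : Type u} [NonUnitalCStarAlgebra D]
    (hD : HasSeparatingFinDimReps D) {n : Type} [Fintype n] (x : n → n → D)
    (hx : ∀ (K : Type u) [NormedAddCommGroup K] [InnerProductSpace ℂ K] [CompleteSpace K]
      [FiniteDimensional ℂ K] (π : D →⋆ₙₐ[ℂ] (K →L[ℂ] K)) (η : n → K),
      (∑ i, ∑ j, ⟪η i, π (x i j) (η j)⟫_ℂ).re ≤ 0)
    {K : Type*} [NormedAddCommGroup K] [InnerProductSpace ℂ K] [CompleteSpace K]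
    (σ : D →⋆ₙₐ[ℂ] (K →L[ℂ] K)) (ξ : n → K) :
    (∑ i, ∑ j, ⟪ξ i, σ (x i j) (ξ j)⟫_ℂ).re ≤ 0 := by
  classical
  let _ : PartialOrder D := CStarAlgebra.spectralOrder D
  have _ : StarOrderedRing D := CStarAlgebra.spectralOrderedRing D
  let X : CStarMatrix n n D := CStarMatrix.ofMatrix x
  have h0 := re_inner_nonpos_of_separating X ?_ (amplification σ) (WithLp.toLp 2 ξ)
  · simp only [PiLp.inner_apply, amplification_apply, inner_sum] at h0
    exact h0
  intro z hz
  obtain ⟨i, j, hij⟩ : ∃ i j, z i j ≠ 0 := by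
    by_contra! hcon
    exact hz (CStarMatrix.ext hcon)
  obtain ⟨L, _, _, _, _, π, hπ⟩ := hD _ hij
  refine ⟨PiLp 2 (fun _ : n => L), inferInstance, inferInstance, inferInstance, amplification π,
    fun h1 => hπ ?_, fun η => ?_⟩
  · ext v
    have h2 := congrArg (fun T => T (WithLp.toLp 2 (Pi.single j v)) i) h1
    simpa [amplification_apply, Pi.single_apply, apply_ite] using h2
  · simp only [PiLp.inner_apply, amplification_apply, inner_sum]
    exact hx L π _

/-! ### Approximation of Gram matrices -/

/-- The direct sum of two ⋆-representations. -/
noncomputable def prodRep {D K L : Type*} [NonUnitalCStarAlgebra D] [NormedAddCommGroup K]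
    [InnerProductSpace ℂ K] [CompleteSpace K] [NormedAddCommGroup L] [InnerProductSpace ℂ L]
    [CompleteSpace L] (π : D →⋆ₙₐ[ℂ] (K →L[ℂ] K)) (ψ : D →⋆ₙₐ[ℂ] (L →L[ℂ] L)) :
    D →⋆ₙₐ[ℂ] (WithLp 2 (K × L) →L[ℂ] WithLp 2 (K × L)) where
  toFun c := (WithLp.prodContinuousLinearEquiv 2 ℂ K L).symm.toContinuousLinearMap ∘L
    ((π c).prodMap (ψ c)) ∘L (WithLp.prodContinuousLinearEquiv 2 ℂ K L).toContinuousLinearMap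
  map_smul' a x := by ext η; exact WithLp.ofLp_injective 2 (Prod.ext (by simp) (by simp))
  map_zero' := by ext η; exact WithLp.ofLp_injective 2 (Prod.ext (by simp) (by simp))
  map_add' x y := by ext η; exact WithLp.ofLp_injective 2 (Prod.ext (by simp) (by simp))
  map_mul' x y := by ext η; exact WithLp.ofLp_injective 2 (Prod.ext (by simp) (by simp))
  map_star' x := by
    rw [ContinuousLinearMap.star_eq_adjoint, ContinuousLinearMap.eq_adjoint_iff]
    intro η ζ
    simp [WithLp.prod_inner_apply, ContinuousLinearMap.star_eq_adjoint,
      ContinuousLinearMap.adjoint_inner_left, map_star]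

theorem prodRep_apply {D K L : Type*} [NonUnitalCStarAlgebra D] [NormedAddCommGroup K]
    [InnerProductSpace ℂ K] [CompleteSpace K] [NormedAddCommGroup L] [InnerProductSpace ℂ L]
    [CompleteSpace L] (π : D →⋆ₙₐ[ℂ] (K →L[ℂ] K)) (ψ : D →⋆ₙₐ[ℂ] (L →L[ℂ] L)) (c : D)
    (x : K) (y : L) :
    prodRep π ψ c (WithLp.toLp 2 (x, y)) = WithLp.toLp 2 (π c x, ψ c y) :=
  rfl

section OrbitGram

variable {α n : Type}

/-- The Gram matrix of the vectors `π (a b) (η i)`, for `b : α` and `i : n`. It is treated as a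
function of a pair of indices. -/
noncomputable def orbitGram {D K : Type*} [NonUnitalCStarAlgebra D] [NormedAddCommGroup K]
    [InnerProductSpace ℂ K] [CompleteSpace K] (a : α → D) (π : D →⋆ₙₐ[ℂ] (K →L[ℂ] K))
    (η : n → K) : (α × n) × (α × n) → ℂ :=
  fun p => ⟪π (a p.1.1) (η p.1.2), π (a p.2.1) (η p.2.2)⟫_ℂ

/-- The Gram matrices `orbitGram a π η` for ⋆-representations `π` on finite-dimensional spaces. -/
def finDimOrbitGrams {D : Type u} [NonUnitalCStarAlgebra D] (n : Type) (a : α → D) :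
    Set ((α × n) × (α × n) → ℂ) :=
  {G | ∃ (K : Type u) (_ : NormedAddCommGroup K) (_ : InnerProductSpace ℂ K) (_ : CompleteSpace K)
    (_ : FiniteDimensional ℂ K) (π : D →⋆ₙₐ[ℂ] (K →L[ℂ] K)) (η : n → K), G = orbitGram a π η}

theorem smul_mem_finDimOrbitGrams {D : Type u} [NonUnitalCStarAlgebra D] {a : α → D}
    {G : (α × n) × (α × n) → ℂ} (hG : G ∈ finDimOrbitGrams n a) {t : ℝ} (ht : 0 ≤ t) :
    t • G ∈ finDimOrbitGrams n a := by
  obtain ⟨K, i1, i2, i3, i4, π, η, rfl⟩ := hG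
  refine ⟨K, i1, i2, i3, i4, π, fun i => ((√t : ℝ) : ℂ) • η i, ?_⟩
  funext p
  simp only [orbitGram, Pi.smul_apply, map_smul, inner_smul_left, inner_smul_right,
    Complex.conj_ofReal, Complex.real_smul]
  rw [← mul_assoc, ← Complex.ofReal_mul, Real.mul_self_sqrt ht]

theorem add_mem_finDimOrbitGrams {D : Type u} [NonUnitalCStarAlgebra D] {a : α → D}
    {G G' : (α × n) × (α × n) → ℂ} (hG : G ∈ finDimOrbitGrams n a)
    (hG' : G' ∈ finDimOrbitGrams n a) : G + G' ∈ finDimOrbitGrams n a := by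
  obtain ⟨K, i1, i2, i3, i4, π, η, rfl⟩ := hG
  obtain ⟨L, j1, j2, j3, j4, ψ, ζ, rfl⟩ := hG'
  have : FiniteDimensional ℂ (WithLp 2 (K × L)) :=
    (WithLp.linearEquiv 2 ℂ (K × L)).symm.finiteDimensional
  refine ⟨WithLp 2 (K × L), inferInstance, inferInstance, inferInstance, this, prodRep π ψ,
    fun i => WithLp.toLp 2 (η i, ζ i), ?_⟩
  funext p
  simp only [orbitGram, prodRep_apply, WithLp.prod_inner_apply, Pi.add_apply]

theorem zero_mem_finDimOrbitGrams {D : Type u} [NonUnitalCStarAlgebra D] (a : α → D) :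
    (0 : (α × n) × (α × n) → ℂ) ∈ finDimOrbitGrams n a :=
  ⟨EuclideanSpace ℂ PUnit.{u + 1}, inferInstance, inferInstance, inferInstance, inferInstance, 0,
    0, by funext p; simp [orbitGram]⟩

/-- Gram matrices of orbits under an arbitrary ⋆-representation are limits of Gram matrices of
orbits under finite-dimensional ones: a separating functional would be a quadratic form that is
nonpositive in all finite-dimensional ⋆-representations, but not in `σ`. -/
theorem orbitGram_mem_closure [Fintype α] [Fintype n] {D : Type u} [NonUnitalCStarAlgebra D]
    (hD : HasSeparatingFinDimReps D) (a : α → D) {K : Type u} [NormedAddCommGroup K]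
    [InnerProductSpace ℂ K] [CompleteSpace K] (σ : D →⋆ₙₐ[ℂ] (K →L[ℂ] K)) (ξ : n → K) :
    orbitGram a σ ξ ∈ closure (finDimOrbitGrams n a) := by
  classical
  by_contra hcon
  have hconv : Convex ℝ (finDimOrbitGrams n a) := fun G hG G' hG' s t hs ht _ =>
    add_mem_finDimOrbitGrams (smul_mem_finDimOrbitGrams hG hs) (smul_mem_finDimOrbitGrams hG' ht)
  obtain ⟨f, u, hf, hu⟩ := RCLike.geometric_hahn_banach_closed_point (𝕜 := ℂ) hconv.closure
    isClosed_closure hcon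
  have hu0 : 0 < u := by
    simpa using hf 0 (subset_closure (zero_mem_finDimOrbitGrams a))
  have hf0 : ∀ G ∈ finDimOrbitGrams n a, (f G).re ≤ 0 := by
    intro G hG
    by_contra! hpos
    -- Scaling brings the value of `f` up to the bound `u`.
    have h1 := hf _ (subset_closure
      (smul_mem_finDimOrbitGrams hG (t := u / (f G).re) (by positivity)))
    have h2 : f ((u / (f G).re) • G) = (((u / (f G).re : ℝ)) : ℂ) * f G := by
      rw [← Complex.coe_smul, map_smul, smul_eq_mul]
    rw [h2] at h1
    change ((((u / (f G).re : ℝ)) : ℂ) * f G).re < u at h1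
    rw [Complex.re_ofReal_mul, div_mul_cancel₀ _ hpos.ne'] at h1
    exact lt_irrefl _ h1
  -- The functional `f` is the quadratic form of the matrix `x`.
  let c : (α × n) × (α × n) → ℂ := fun p => f (fun q => if p = q then 1 else 0)
  let x : n → n → D := fun i j => ∑ b, ∑ d, c ((b, i), (d, j)) • (star (a b) * a d)
  have hform : ∀ {L : Type u} [NormedAddCommGroup L] [InnerProductSpace ℂ L] [CompleteSpace L]
      (π : D →⋆ₙₐ[ℂ] (L →L[ℂ] L)) (η : n → L),
      ∑ i, ∑ j, ⟪η i, π (x i j) (η j)⟫_ℂ = f (orbitGram a π η) := by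
    intro L _ _ _ π η
    have h1 : f (orbitGram a π η) = ∑ p, orbitGram a π η p • c p :=
      LinearMap.pi_apply_eq_sum_univ f.toLinearMap (orbitGram a π η)
    rw [h1]
    have h2 : ∀ i j, ⟪η i, π (x i j) (η j)⟫_ℂ
        = ∑ b, ∑ d, orbitGram a π η ((b, i), (d, j)) • c ((b, i), (d, j)) := by
      intro i j
      simp only [x, map_sum, map_smul, map_mul, map_star, _root_.sum_apply, inner_sum]
      refine Finset.sum_congr rfl fun b _ => Finset.sum_congr rfl fun d _ => ?_
      rw [_root_.smul_apply, ContinuousLinearMap.mul_def, ContinuousLinearMap.comp_apply,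
        inner_smul_right, ContinuousLinearMap.star_eq_adjoint,
        ContinuousLinearMap.adjoint_inner_right, smul_eq_mul, mul_comm]
      rfl
    simp only [h2, Fintype.sum_prod_type]
    -- Reorder the sum over `i, j, b, d` as a sum over `(b, i), (d, j)`.
    refine Eq.trans ?_ Finset.sum_comm
    refine Finset.sum_congr rfl fun i _ => Finset.sum_comm.trans ?_
    exact Finset.sum_congr rfl fun b _ => Finset.sum_comm
  have h1 := re_sum_inner_nonpos hD x (fun L _ _ _ _ π η => by
    rw [hform]
    exact hf0 _ ⟨L, _, _, _, ‹_›, π, η, rfl⟩) σ ξ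
  rw [hform] at h1
  change u < (f (orbitGram a σ ξ)).re at hu
  linarith

end OrbitGram

/-! ### Isometries with prescribed values -/

/-- Vectors with the same Gram matrix are related by a linear isometry. -/
theorem exists_linearIsometry_span {H K : Type*} [NormedAddCommGroup H] [InnerProductSpace ℂ H]
    [NormedAddCommGroup K] [InnerProductSpace ℂ K] {ι : Type*} [Fintype ι] {w : ι → H} {v : ι → K}
    (h : ∀ i j, ⟪w i, w j⟫_ℂ = ⟪v i, v j⟫_ℂ) :
    ∃ L : Submodule.span ℂ (Set.range w) →ₗᵢ[ℂ] K,
      ∀ i, L ⟨w i, Submodule.subset_span ⟨i, rfl⟩⟩ = v i := by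
  let Tw : (ι → ℂ) →ₗ[ℂ] H := Fintype.linearCombination ℂ w
  let Tv : (ι → ℂ) →ₗ[ℂ] K := Fintype.linearCombination ℂ v
  have hnorm : ∀ c, ‖Tw c‖ = ‖Tv c‖ := by
    intro c
    have h1 : ⟪Tw c, Tw c⟫_ℂ = ⟪Tv c, Tv c⟫_ℂ := by
      simp only [Tw, Tv, Fintype.linearCombination_apply, sum_inner, inner_sum, inner_smul_left,
        inner_smul_right, h]
    rw [inner_self_eq_norm_sq_to_K, inner_self_eq_norm_sq_to_K] at h1
    have h2 : ‖Tw c‖ ^ 2 = ‖Tv c‖ ^ 2 := by exact_mod_cast h1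
    exact (sq_eq_sq₀ (norm_nonneg _) (norm_nonneg _)).1 h2
  have hrange : LinearMap.range Tw = Submodule.span ℂ (Set.range w) :=
    Fintype.range_linearCombination ℂ w
  have hsurj : ∀ x : Submodule.span ℂ (Set.range w), ∃ c, Tw c = x := fun x => by
    exact LinearMap.mem_range.1 (hrange.symm ▸ x.2 : (x : H) ∈ LinearMap.range Tw)
  choose s hs using hsurj
  have hwd : ∀ c d, Tw c = Tw d → Tv c = Tv d := by
    intro c d hcd
    rw [← sub_eq_zero, ← norm_eq_zero, ← map_sub, ← hnorm, map_sub, hcd, sub_self, norm_zero]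
  refine ⟨⟨⟨⟨fun x => Tv (s x), fun x y => ?_⟩, fun c x => ?_⟩, fun x => ?_⟩, fun i => ?_⟩
  · rw [← map_add]
    exact hwd _ _ (by rw [map_add, hs, hs, hs]; rfl)
  · rw [RingHom.id_apply, ← map_smul]
    exact hwd _ _ (by rw [map_smul, hs, hs]; rfl)
  · change ‖Tv (s x)‖ = ‖x‖
    rw [← hnorm, hs]; rfl
  · classical
    have h1 : Tv (Pi.single i 1) = v i := by simp [Tv]
    have h2 : Tw (Pi.single i 1) = w i := by simp [Tw]
    change Tv (s _) = v i
    rw [← h1]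
    exact hwd _ _ (by rw [hs, h2])

/-- A linear isometry from a subspace of a finite-dimensional space into an infinite-dimensional
Hilbert space extends to the whole space. -/
theorem exists_linearIsometry_extension {H K : Type*} [NormedAddCommGroup H]
    [InnerProductSpace ℂ H] [FiniteDimensional ℂ H] [NormedAddCommGroup K] [InnerProductSpace ℂ K]
    [CompleteSpace K] (hK : ¬ FiniteDimensional ℂ K) {S : Submodule ℂ H} (L : S →ₗᵢ[ℂ] K) :
    ∃ V : H →ₗᵢ[ℂ] K, ∀ x : S, V x = L x := by
  let R : Submodule ℂ K := LinearMap.range L.toLinearMap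
  have hR : ¬ FiniteDimensional ℂ Rᗮ := by
    intro hfin
    refine hK ?_
    have h1 : FiniteDimensional ℂ (R ⊔ Rᗮ : Submodule ℂ K) := Submodule.finiteDimensional_sup _ _
    rw [Submodule.sup_orthogonal_of_hasOrthogonalProjection] at h1
    exact Submodule.topEquiv.finiteDimensional
  -- An isometric copy of `Sᗮ` inside `Rᗮ`.
  obtain ⟨b, hb⟩ : ∃ b : Fin (Module.finrank ℂ Sᗮ) → Rᗮ, Orthonormal ℂ b := by
    have hrank : ((Module.finrank ℂ Sᗮ : ℕ) : Cardinal) ≤ Module.rank ℂ Rᗮ := by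
      by_contra! hlt
      exact hR (Module.rank_lt_aleph0_iff.1 (hlt.trans Cardinal.natCast_lt_aleph0))
    obtain ⟨f, hf⟩ := exists_linearIndependent_of_le_rank hrank
    exact ⟨_, InnerProductSpace.gramSchmidtNormed_orthonormal hf⟩
  let e := stdOrthonormalBasis ℂ Sᗮ
  let J : Sᗮ →ₗᵢ[ℂ] Rᗮ := (e.toBasis.constr ℂ b).isometryOfOrthonormal (v := e.toBasis)
    (by simp [e.orthonormal]) (by
      convert hb
      ext1 i
      simp only [Function.comp_apply, Module.Basis.constr_basis])
  let V : H →ₗ[ℂ] K := L.toLinearMap ∘ₗ (S.orthogonalProjectionOnto).toLinearMap +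
    (Rᗮ.subtypeₗᵢ.toLinearMap ∘ₗ J.toLinearMap) ∘ₗ (Sᗮ.orthogonalProjectionOnto).toLinearMap
  have hV : ∀ x, V x = L (S.orthogonalProjectionOnto x) + J (Sᗮ.orthogonalProjectionOnto x) :=
    fun _ => rfl
  refine ⟨⟨V, fun x => ?_⟩, fun x => ?_⟩
  · have horth : ⟪L (S.orthogonalProjectionOnto x), (J (Sᗮ.orthogonalProjectionOnto x) : K)⟫_ℂ = 0 :=
      Submodule.inner_right_of_mem_orthogonal (K := R) ⟨_, rfl⟩ (J _).2
    rw [← sq_eq_sq₀ (norm_nonneg _) (norm_nonneg _), Submodule.norm_sq_eq_add_norm_sq_projection x S,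
      hV, sq, norm_add_sq_eq_norm_sq_add_norm_sq_of_inner_eq_zero _ _ horth, L.norm_map,
      ← Submodule.coe_norm, J.norm_map, sq, sq]
  · change V x = L x
    have h0 : Sᗮ.orthogonalProjectionOnto (x : H) = 0 :=
      Submodule.orthogonalProjectionOnto_eq_zero_iff.2 (S.le_orthogonal_orthogonal x.2)
    rw [hV, h0]
    simp

/-- Vectors with the same Gram matrix, the second ones in an infinite-dimensional space, are
related by an isometry of the whole ambient space. -/
theorem exists_linearIsometry_of_gram_eq {H K : Type*} [NormedAddCommGroup H]
    [InnerProductSpace ℂ H] [FiniteDimensional ℂ H] [NormedAddCommGroup K] [InnerProductSpace ℂ K]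
    [CompleteSpace K] (hK : ¬ FiniteDimensional ℂ K) {ι : Type*} [Fintype ι] {w : ι → H} {v : ι → K}
    (h : ∀ i j, ⟪w i, w j⟫_ℂ = ⟪v i, v j⟫_ℂ) : ∃ V : H →ₗᵢ[ℂ] K, ∀ i, V (w i) = v i := by
  obtain ⟨L, hL⟩ := exists_linearIsometry_span h
  obtain ⟨V, hV⟩ := exists_linearIsometry_extension hK L
  exact ⟨V, fun i => (hV ⟨w i, _⟩).trans (hL i)⟩

open scoped MatrixOrder ComplexOrder in
/-- A finite family of vectors has the same Gram matrix as a family in `ℂ^ι`. -/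
theorem exists_euclidean_gram_eq {H : Type*} [NormedAddCommGroup H] [InnerProductSpace ℂ H]
    {ι : Type*} [Fintype ι] (w : ι → H) :
    ∃ z : ι → EuclideanSpace ℂ ι, ∀ i j, ⟪z i, z j⟫_ℂ = ⟪w i, w j⟫_ℂ := by
  classical
  obtain ⟨B, hB⟩ := CStarAlgebra.nonneg_iff_eq_star_mul_self.1 (Matrix.posSemidef_gram ℂ w).nonneg
  refine ⟨fun i => WithLp.toLp 2 (fun k => B k i), fun i j => ?_⟩
  have h1 : Matrix.gram ℂ w i j = ⟪w i, w j⟫_ℂ := rfl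
  rw [← h1, hB]
  simp [Matrix.mul_apply, PiLp.inner_apply, mul_comm]

open Filter in
/-- If the Gram matrices of the families `w m` converge to the one of `v`, then isometric copies of
a subsequence of `w` converge to `v`. -/
theorem exists_linearIsometry_near_of_gram_tendsto {H : ℕ → Type*} [∀ m, NormedAddCommGroup (H m)]
    [∀ m, InnerProductSpace ℂ (H m)] [∀ m, FiniteDimensional ℂ (H m)] {K : Type*}
    [NormedAddCommGroup K] [InnerProductSpace ℂ K] [CompleteSpace K]
    (hK : ¬ FiniteDimensional ℂ K) {ι : Type*} [Fintype ι] (w : ∀ m, ι → H m) (v : ι → K)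
    (h : ∀ i j, Tendsto (fun m => ⟪w m i, w m j⟫_ℂ) atTop (𝓝 ⟪v i, v j⟫_ℂ)) {ε : ℝ} (hε : 0 < ε) :
    ∃ m, ∃ V : H m →ₗᵢ[ℂ] K, ∀ i, ‖V (w m i) - v i‖ < ε := by
  -- The families are realised in one finite-dimensional space, where compactness applies.
  choose z hz using fun m => exists_euclidean_gram_eq (w m)
  have hbdd : Bornology.IsBounded (Set.range z) := by
    have hsq : ∀ i, ∃ c, ∀ m, ‖z m i‖ ^ 2 ≤ c := by
      intro i
      obtain ⟨c, hc⟩ := ((h i i).norm).bddAbove_range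
      refine ⟨c, fun m => (le_of_eq ?_).trans (hc ⟨m, rfl⟩)⟩
      change _ = ‖⟪w m i, w m i⟫_ℂ‖
      rw [← hz, inner_self_eq_norm_sq_to_K]
      simp
    choose c hc using hsq
    refine (Metric.isBounded_iff_subset_closedBall 0).2 ⟨∑ i, (c i + 1), ?_⟩
    rintro _ ⟨m, rfl⟩
    have hc0 : ∀ i, 0 ≤ c i + 1 := fun i => by nlinarith [hc i m, sq_nonneg ‖z m i‖]
    rw [mem_closedBall_zero_iff, pi_norm_le_iff_of_nonneg (Finset.sum_nonneg fun i _ => hc0 i)]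
    intro i
    refine le_trans ?_ (Finset.single_le_sum (fun i _ => hc0 i) (Finset.mem_univ i))
    nlinarith [hc i m, sq_nonneg (‖z m i‖ - 1)]
  obtain ⟨y, -, φ, hφ, hy⟩ := tendsto_subseq_of_bounded hbdd (fun m => ⟨m, rfl⟩)
  have hyi : ∀ i, Tendsto (fun m => z (φ m) i) atTop (𝓝 (y i)) := fun i =>
    (tendsto_pi_nhds.1 hy) i
  have hgram : ∀ i j, ⟪y i, y j⟫_ℂ = ⟪v i, v j⟫_ℂ := by
    intro i j
    refine tendsto_nhds_unique ((hyi i).inner (hyi j)) ?_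
    simp only [hz]
    exact (h i j).comp hφ.tendsto_atTop
  obtain ⟨J, hJ⟩ := exists_linearIsometry_of_gram_eq hK hgram
  have hnear : ∀ᶠ m in atTop, ∀ i, ‖z (φ m) i - y i‖ < ε := by
    rw [eventually_all]
    intro i
    have := (Metric.tendsto_nhds.1 (hyi i)) ε hε
    simpa [dist_eq_norm] using this
  obtain ⟨m, hm⟩ := hnear.exists
  obtain ⟨V, hV⟩ := exists_linearIsometry_of_gram_eq (w := w (φ m)) (v := fun i => J (z (φ m) i)) hK
    (fun i j => by rw [J.inner_map_map, hz])
  refine ⟨φ m, V, fun i => ?_⟩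
  rw [hV, ← hJ, ← map_sub, J.norm_map]
  exact hm i

/-! ### Approximation by representations of finite rank -/

theorem LinearIsometry.adjoint_apply_apply {H K : Type*} [NormedAddCommGroup H]
    [InnerProductSpace ℂ H] [CompleteSpace H] [NormedAddCommGroup K] [InnerProductSpace ℂ K]
    [CompleteSpace K] (V : H →ₗᵢ[ℂ] K) (x : H) :
    ContinuousLinearMap.adjoint V.toContinuousLinearMap (V x) = x := by
  refine ext_inner_left ℂ fun y => ?_
  rw [ContinuousLinearMap.adjoint_inner_right]
  exact V.inner_map_map y x

/-- The ⋆-representation `c ↦ V π(c) V⋆` on `K` obtained from a ⋆-representation `π` on `H` and an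
isometry `V : H → K`. It vanishes on the orthogonal complement of the range of `V`. -/
noncomputable def conjRep {D H K : Type*} [NonUnitalCStarAlgebra D] [NormedAddCommGroup H]
    [InnerProductSpace ℂ H] [CompleteSpace H] [NormedAddCommGroup K] [InnerProductSpace ℂ K]
    [CompleteSpace K] (V : H →ₗᵢ[ℂ] K) (π : D →⋆ₙₐ[ℂ] (H →L[ℂ] H)) :
    D →⋆ₙₐ[ℂ] (K →L[ℂ] K) where
  toFun c := V.toContinuousLinearMap ∘L π c ∘L
    ContinuousLinearMap.adjoint V.toContinuousLinearMap
  map_smul' a c := by ext x; simp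
  map_zero' := by ext x; simp
  map_add' c d := by ext x; simp
  map_mul' c d := by ext x; simp [V.adjoint_apply_apply]
  map_star' c := by
    rw [ContinuousLinearMap.star_eq_adjoint, ContinuousLinearMap.eq_adjoint_iff]
    intro x y
    change ⟪V (π (star c) (ContinuousLinearMap.adjoint V.toContinuousLinearMap x)), y⟫_ℂ =
      ⟪x, V (π c (ContinuousLinearMap.adjoint V.toContinuousLinearMap y))⟫_ℂ
    have h1 : ∀ z y, ⟪V z, y⟫_ℂ = ⟪z, ContinuousLinearMap.adjoint V.toContinuousLinearMap y⟫_ℂ :=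
      fun z y => (ContinuousLinearMap.adjoint_inner_right V.toContinuousLinearMap z y).symm
    have h2 : ∀ z y, ⟪y, V z⟫_ℂ = ⟪ContinuousLinearMap.adjoint V.toContinuousLinearMap y, z⟫_ℂ :=
      fun z y => (ContinuousLinearMap.adjoint_inner_left V.toContinuousLinearMap z y).symm
    rw [h1, h2, map_star, ContinuousLinearMap.star_eq_adjoint,
      ContinuousLinearMap.adjoint_inner_left]

theorem conjRep_apply {D H K : Type*} [NonUnitalCStarAlgebra D] [NormedAddCommGroup H]
    [InnerProductSpace ℂ H] [CompleteSpace H] [NormedAddCommGroup K] [InnerProductSpace ℂ K]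
    [CompleteSpace K] (V : H →ₗᵢ[ℂ] K) (π : D →⋆ₙₐ[ℂ] (H →L[ℂ] H)) (c : D) (x : K) :
    conjRep V π c x = V (π c (ContinuousLinearMap.adjoint V.toContinuousLinearMap x)) :=
  rfl

theorem conjRep_apply_map {D H K : Type*} [NonUnitalCStarAlgebra D] [NormedAddCommGroup H]
    [InnerProductSpace ℂ H] [CompleteSpace H] [NormedAddCommGroup K] [InnerProductSpace ℂ K]
    [CompleteSpace K] (V : H →ₗᵢ[ℂ] K) (π : D →⋆ₙₐ[ℂ] (H →L[ℂ] H)) (c : D) (x : H) :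
    conjRep V π c (V x) = V (π c x) := by
  rw [conjRep_apply, V.adjoint_apply_apply]

/-- The approximation of a unital ⋆-representation on finitely many elements and vectors, on an
infinite-dimensional space. -/
theorem exists_finiteRank_rep_near_of_unital {D : Type u} [CStarAlgebra D]
    (hD : HasSeparatingFinDimReps D) {K : Type u} [NormedAddCommGroup K] [InnerProductSpace ℂ K]
    [CompleteSpace K] (hK : ¬ FiniteDimensional ℂ K) (σ : D →⋆ₙₐ[ℂ] (K →L[ℂ] K)) (hσ : σ 1 = 1)
    {N m : ℕ} (c : Fin N → D) (ξ : Fin m → K) {ε : ℝ} (hε : 0 < ε) :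
    ∃ (τ : D →⋆ₙₐ[ℂ] (K →L[ℂ] K)) (E : Submodule ℂ K), FiniteDimensional ℂ E ∧
      (∀ d x, τ d x ∈ E) ∧ ∀ b i, ‖τ (c b) (ξ i) - σ (c b) (ξ i)‖ < ε := by
  -- The unit is added to the list in order to approximate the vectors `ξ i` themselves.
  let a : Option (Fin N) → D := fun b => b.elim 1 c
  obtain ⟨G, hG, hlim⟩ := mem_closure_iff_seq_limit.1 (orbitGram_mem_closure hD a σ ξ)
  choose H i1 i2 i3 i4 π η hη using hG
  let M : ℝ := ∑ b, ‖c b‖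
  have hM : 0 ≤ M := Finset.sum_nonneg fun b _ => norm_nonneg _
  obtain ⟨k, V, hV⟩ := exists_linearIsometry_near_of_gram_tendsto hK
    (fun k (p : Option (Fin N) × Fin m) => π k (a p.1) (η k p.2)) (fun p => σ (a p.1) (ξ p.2))
    (fun p q => by
      have := (tendsto_pi_nhds.1 hlim) (p, q)
      simp only [hη] at this
      exact this) (ε := ε / (M + 1)) (by positivity)
  refine ⟨conjRep V (π k), LinearMap.range V.toLinearMap, inferInstance, fun d x => ⟨_, rfl⟩,
    fun b i => ?_⟩
  -- The approximants `π k` need not be unital, so `V (π k 1 (η k i))` replaces `V (η k i)`.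
  have h0 : ‖V (π k 1 (η k i)) - ξ i‖ < ε / (M + 1) := by
    simpa [a, hσ] using hV (none, i)
  have h1 : ‖V (π k (c b) (η k i)) - σ (c b) (ξ i)‖ < ε / (M + 1) := hV (some b, i)
  have h2 : conjRep V (π k) (c b) (V (π k 1 (η k i))) = V (π k (c b) (η k i)) := by
    rw [conjRep_apply_map, ← ContinuousLinearMap.comp_apply, ← ContinuousLinearMap.mul_def,
      ← map_mul, mul_one]
  have h3 : conjRep V (π k) (c b) (ξ i) - σ (c b) (ξ i)
      = (V (π k (c b) (η k i)) - σ (c b) (ξ i))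
        - conjRep V (π k) (c b) (V (π k 1 (η k i)) - ξ i) := by
    rw [map_sub, h2]; abel
  have hcM : ‖c b‖ ≤ M := Finset.single_le_sum (f := fun b => ‖c b‖)
    (fun _ _ => norm_nonneg _) (Finset.mem_univ b)
  calc ‖conjRep V (π k) (c b) (ξ i) - σ (c b) (ξ i)‖
      ≤ ‖V (π k (c b) (η k i)) - σ (c b) (ξ i)‖
        + ‖conjRep V (π k) (c b) (V (π k 1 (η k i)) - ξ i)‖ := by rw [h3]; exact norm_sub_le _ _
    _ ≤ ‖V (π k (c b) (η k i)) - σ (c b) (ξ i)‖ + M * ‖V (π k 1 (η k i)) - ξ i‖ := by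
        gcongr
        refine (ContinuousLinearMap.le_opNorm _ _).trans ?_
        gcongr
        exact (NonUnitalStarAlgHom.norm_apply_le (conjRep V (π k)) (c b)).trans hcM
    _ < ε / (M + 1) + M * (ε / (M + 1)) := add_lt_add_of_lt_of_le h1 (by gcongr)
    _ = ε := by field_simp; ring

/-- The trivial character separates the adjoined unit from `C`. -/
theorem HasSeparatingFinDimReps.unitization {C : Type u} [NonUnitalCStarAlgebra C]
    (hC : HasSeparatingFinDimReps C) : HasSeparatingFinDimReps (Unitization ℂ C) := by
  intro d hd
  by_cases h : d.fst = 0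
  · have hc : d.snd ≠ 0 := fun hc => hd (Unitization.ext h hc)
    obtain ⟨K, i1, i2, i3, i4, π, hπ⟩ := hC _ hc
    refine ⟨K, i1, i2, i3, i4, (Unitization.starLift π : _ →⋆ₐ[ℂ] _), ?_⟩
    simpa [Unitization.starLift, Unitization.lift, h] using hπ
  · let K := EuclideanSpace ℂ PUnit.{u + 1}
    refine ⟨K, inferInstance, inferInstance, inferInstance, inferInstance,
      (Unitization.starLift (0 : C →⋆ₙₐ[ℂ] (K →L[ℂ] K)) : _ →⋆ₐ[ℂ] _), ?_⟩
    simpa [Unitization.starLift, Unitization.lift] using h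

/-- If the finite-dimensional ⋆-representations of `C` separate points, then every
⋆-representation of `C` is a point-strong limit of ⋆-representations on the same space, whose
operators have ranges in a common finite-dimensional subspace. -/
theorem exists_finiteRank_rep_near {C : Type u} [NonUnitalCStarAlgebra C]
    (hC : HasSeparatingFinDimReps C) {K : Type u} [NormedAddCommGroup K] [InnerProductSpace ℂ K]
    [CompleteSpace K] (σ : C →⋆ₙₐ[ℂ] (K →L[ℂ] K)) (F : Finset C) (X : Finset K) {ε : ℝ}
    (hε : 0 < ε) :
    ∃ (τ : C →⋆ₙₐ[ℂ] (K →L[ℂ] K)) (E : Submodule ℂ K), FiniteDimensional ℂ E ∧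
      (∀ d x, τ d x ∈ E) ∧ ∀ c ∈ F, ∀ ξ ∈ X, ‖τ c ξ - σ c ξ‖ < ε := by
  by_cases hK : FiniteDimensional ℂ K
  · exact ⟨σ, ⊤, inferInstance, fun _ _ => trivial, fun _ _ _ _ => by simpa using hε⟩
  let σ₁ : Unitization ℂ C →⋆ₐ[ℂ] (K →L[ℂ] K) := Unitization.starLift σ
  obtain ⟨τ, E, hE, hτE, hτ⟩ := exists_finiteRank_rep_near_of_unital hC.unitization hK
    (σ₁ : Unitization ℂ C →⋆ₙₐ[ℂ] (K →L[ℂ] K)) (map_one σ₁)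
    (fun b => ((F.equivFin.symm b : C) : Unitization ℂ C)) (fun i => (X.equivFin.symm i : K)) hε
  refine ⟨τ.comp (Unitization.inrNonUnitalStarAlgHom ℂ C), E, hE, fun d x => hτE _ x,
    fun c hc ξ hξ => ?_⟩
  have h := hτ (F.equivFin ⟨c, hc⟩) (X.equivFin ⟨ξ, hξ⟩)
  simp only [Equiv.symm_apply_apply] at h
  have h1 : (σ₁ : Unitization ℂ C →⋆ₙₐ[ℂ] (K →L[ℂ] K)) (c : Unitization ℂ C) = σ c :=
    DFunLike.congr_fun (Unitization.starLift.symm_apply_apply σ) c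
  rw [h1] at h
  exact h

/-! ### Exel–Loring approximations -/

theorem IsCompletelyContractive.starAlgHom_comp {A C D : Type*} [NonUnitalRing A] [Module ℂ A]
    [MatrixNormed A] [NonUnitalCStarAlgebra C] [NonUnitalCStarAlgebra D] {υ : A →ₙₐ[ℂ] C}
    (hυ : IsCompletelyIsometric υ) (σ : C →⋆ₙₐ[ℂ] D) :
    IsCompletelyContractive ((σ : C →ₙₐ[ℂ] D).comp υ) := fun n x =>
  (mnorm_map_le σ (x.map υ)).trans (hυ n x).le

theorem IsCStarCover.mem_closure_range_eval {A C : Type u} [NonUnitalRing A] [Module ℂ A]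
    [MatrixNormed A] [NonUnitalCStarAlgebra C] {υ : A →ₙₐ[ℂ] C} (hυ : IsCStarCover υ) (c : C) :
    c ∈ closure (Set.range (StarPoly.eval υ)) := by
  rw [← mem_cstarGenerated_range_iff, hυ.generates]
  exact trivial

/-- If the operators `τ c` have ranges in a finite-dimensional subspace, then so does the
essential space of `τ ∘ υ`. -/
theorem finiteDimensional_essentialSpace {A C : Type u} [NonUnitalRing A] [Module ℂ A]
    [NonUnitalCStarAlgebra C] (υ : A →ₙₐ[ℂ] C) {K : Type u} [NormedAddCommGroup K]
    [InnerProductSpace ℂ K] [CompleteSpace K] (τ : C →⋆ₙₐ[ℂ] (K →L[ℂ] K)) {E : Submodule ℂ K}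
    [FiniteDimensional ℂ E] (hE : ∀ c x, τ c x ∈ E) :
    FiniteDimensional ℂ (essentialSpace ((τ : C →ₙₐ[ℂ] (K →L[ℂ] K)).comp υ)) := by
  have hle : essentialSpace ((τ : C →ₙₐ[ℂ] (K →L[ℂ] K)).comp υ) ≤ E := by
    refine Submodule.span_le.2 ?_
    rintro _ ⟨T, hT, ξ, rfl⟩
    have hcl : IsClosed {T : K →L[ℂ] K | T ξ ∈ E} :=
      E.closed_of_finiteDimensional.preimage (ContinuousLinearMap.apply ℂ K ξ).continuous
    refine hcl.closure_subset_iff.2 ?_ ((mem_cstarGenerated_range_iff _ T).1 hT)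
    rintro _ ⟨e, rfl⟩
    have h1 : e.eval ((τ : C →ₙₐ[ℂ] (K →L[ℂ] K)).comp υ) = τ (e.eval υ) :=
      (StarPoly.map_eval υ τ e).symm
    rw [Set.mem_ofPred_eq, h1]
    exact hE _ _
  exact Submodule.finiteDimensional_of_le hle

open Filter in
/-- If the finite-dimensional ⋆-representations of `C` separate points, then the approximants of `σ` on
finite sets form an Exel–Loring approximation of `σ ∘ υ`. The adjoints converge because the
approximants are ⋆-representations of all of `C`. -/
theorem admitsExelLoringApproximation_of_separating {A C : Type u} [NonUnitalRing A] [Module ℂ A]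
    [MatrixNormed A] [NonUnitalCStarAlgebra C] {υ : A →ₙₐ[ℂ] C} (hυ : IsCompletelyIsometric υ)
    (hC : HasSeparatingFinDimReps C) {K : Type u} [NormedAddCommGroup K] [InnerProductSpace ℂ K]
    [CompleteSpace K] (σ : C →⋆ₙₐ[ℂ] (K →L[ℂ] K)) :
    AdmitsExelLoringApproximation ((σ : C →ₙₐ[ℂ] (K →L[ℂ] K)).comp υ) := by
  classical
  let Λ := Finset C × Finset K × ℕ
  have hpos : ∀ l : Λ, 0 < 1 / ((l.2.2 : ℝ) + 1) := fun l => by positivity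
  choose τ E hE hτE hτ using fun l : Λ => exists_finiteRank_rep_near hC σ l.1 l.2.1 (hpos l)
  have hlim : ∀ (c : C) (ξ : K), Tendsto (fun l => τ l c ξ) atTop (𝓝 (σ c ξ)) := by
    intro c ξ
    rw [Metric.tendsto_nhds]
    intro ε hε
    obtain ⟨k, hk⟩ := exists_nat_one_div_lt hε
    filter_upwards [eventually_ge_atTop (({c}, {ξ}, k) : Λ)] with l hl
    have h1 := hτ l c (hl.1 (Finset.mem_singleton_self c)) ξ (hl.2.1 (Finset.mem_singleton_self ξ))
    rw [dist_eq_norm]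
    refine h1.trans (lt_of_le_of_lt ?_ hk)
    have h2 : (k : ℝ) ≤ l.2.2 := by exact_mod_cast hl.2.2
    exact one_div_le_one_div_of_le (by positivity) (by linarith)
  refine ⟨Λ, inferInstance, inferInstance, inferInstance,
    fun l => (τ l : C →ₙₐ[ℂ] (K →L[ℂ] K)).comp υ,
    fun l => IsCompletelyContractive.starAlgHom_comp hυ (τ l), fun l => ?_,
    fun a ξ => hlim (υ a) ξ, fun a ξ => ?_⟩
  · have := hE l
    exact finiteDimensional_essentialSpace υ (τ l) (hτE l)
  · have h := hlim (star (υ a)) ξ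
    simp only [map_star] at h
    exact h

/-! ### From approximations to residual finite-dimensionality -/

open Filter in
/-- Strong convergence of ⋆-representations, together with the adjoints, on generators implies
strong convergence everywhere, because ⋆-representations are uniformly bounded. -/
theorem tendsto_apply_of_tendsto_generators {A C : Type u} [NonUnitalRing A] [Module ℂ A]
    [MatrixNormed A] [NonUnitalCStarAlgebra C] {υ : A →ₙₐ[ℂ] C} (hυ : IsCStarCover υ)
    {K : Type*} [NormedAddCommGroup K] [InnerProductSpace ℂ K] [CompleteSpace K] {Λ : Type*}
    {l : Filter Λ} {τ : Λ → C →⋆ₙₐ[ℂ] (K →L[ℂ] K)} {σ : C →⋆ₙₐ[ℂ] (K →L[ℂ] K)}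
    (h : ∀ a ξ, Tendsto (fun i => τ i (υ a) ξ) l (𝓝 (σ (υ a) ξ)))
    (h' : ∀ a ξ, Tendsto (fun i => star (τ i (υ a)) ξ) l (𝓝 (star (σ (υ a)) ξ)))
    (c : C) (ξ : K) : Tendsto (fun i => τ i c ξ) l (𝓝 (σ c ξ)) := by
  have hmul : ∀ c d : C, (∀ ξ, Tendsto (fun i => τ i c ξ) l (𝓝 (σ c ξ))) →
      (∀ ξ, Tendsto (fun i => τ i d ξ) l (𝓝 (σ d ξ))) →
      ∀ ξ, Tendsto (fun i => τ i (c * d) ξ) l (𝓝 (σ (c * d) ξ)) := by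
    intro c d hc hd ξ
    simp only [map_mul, ContinuousLinearMap.mul_def, ContinuousLinearMap.comp_apply]
    rw [tendsto_iff_norm_sub_tendsto_zero]
    have h1 := tendsto_iff_norm_sub_tendsto_zero.1 (hd ξ)
    have h2 := tendsto_iff_norm_sub_tendsto_zero.1 (hc (σ d ξ))
    refine squeeze_zero (fun _ => norm_nonneg _) (fun i => ?_)
      (by simpa using (h1.const_mul ‖c‖).add h2)
    have h3 : τ i c (τ i d ξ) - σ c (σ d ξ)
        = τ i c (τ i d ξ - σ d ξ) + (τ i c (σ d ξ) - σ c (σ d ξ)) := by rw [map_sub]; abel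
    rw [h3]
    refine (norm_add_le _ _).trans ?_
    gcongr
    refine (ContinuousLinearMap.le_opNorm _ _).trans ?_
    gcongr
    exact NonUnitalStarAlgHom.norm_apply_le (τ i) c
  have hpoly : ∀ e : StarPoly A,
      (∀ ξ, Tendsto (fun i => τ i (e.eval υ) ξ) l (𝓝 (σ (e.eval υ) ξ))) ∧
      ∀ ξ, Tendsto (fun i => τ i (star (e.eval υ)) ξ) l (𝓝 (σ (star (e.eval υ)) ξ)) := by
    intro e
    induction e with
    | gen a => exact ⟨h a, fun ξ => by simpa only [map_star, StarPoly.eval] using h' a ξ⟩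
    | add e f he hf =>
      constructor
      · intro ξ
        simpa [StarPoly.eval] using (he.1 ξ).add (hf.1 ξ)
      · intro ξ
        simpa only [StarPoly.eval, star_add, map_add, _root_.add_apply] using
          (he.2 ξ).add (hf.2 ξ)
    | mul e f he hf =>
      constructor
      · exact hmul _ _ he.1 hf.1
      · simp only [StarPoly.eval, star_mul]
        exact hmul _ _ hf.2 he.2
    | smul r e he =>
      constructor
      · intro ξ
        simpa [StarPoly.eval] using (he.1 ξ).const_smul r
      · intro ξ
        simpa only [StarPoly.eval, star_smul, map_smul, _root_.smul_apply] using
          (he.2 ξ).const_smul (star r)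
    | star e he =>
      refine ⟨he.2, ?_⟩
      simpa only [StarPoly.eval, star_star] using he.1
  rw [Metric.tendsto_nhds]
  intro ε hε
  obtain ⟨_, ⟨e, rfl⟩, he⟩ := Metric.mem_closure_iff.1 (hυ.mem_closure_range_eval c)
    (ε / (3 * (‖ξ‖ + 1))) (by positivity)
  rw [dist_eq_norm] at he
  have hsmall : ∀ ψ : C →⋆ₙₐ[ℂ] (K →L[ℂ] K), ‖ψ c ξ - ψ (e.eval υ) ξ‖ < ε / 3 := by
    intro ψ
    have h1 : ‖ψ c ξ - ψ (e.eval υ) ξ‖ ≤ ‖c - e.eval υ‖ * ‖ξ‖ := by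
      rw [← _root_.sub_apply, ← map_sub]
      refine (ContinuousLinearMap.le_opNorm _ _).trans ?_
      gcongr
      exact NonUnitalStarAlgHom.norm_apply_le ψ _
    calc ‖ψ c ξ - ψ (e.eval υ) ξ‖ ≤ ‖c - e.eval υ‖ * (‖ξ‖ + 1) := by
          refine h1.trans ?_
          gcongr
          linarith
      _ < ε / (3 * (‖ξ‖ + 1)) * (‖ξ‖ + 1) := by gcongr
      _ = ε / 3 := by field_simp
  filter_upwards [Metric.tendsto_nhds.1 ((hpoly e).1 ξ) (ε / 3) (by positivity)] with i hi
  rw [dist_eq_norm] at hi ⊢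
  have h1 := hsmall (τ i)
  have h2 := hsmall σ
  have h3 : τ i c ξ - σ c ξ = (τ i c ξ - τ i (e.eval υ) ξ) +
      (τ i (e.eval υ) ξ - σ (e.eval υ) ξ) - (σ c ξ - σ (e.eval υ) ξ) := by abel
  rw [h3]
  have h4 := norm_sub_le ((τ i c ξ - τ i (e.eval υ) ξ) +
      (τ i (e.eval υ) ξ - σ (e.eval υ) ξ)) (σ c ξ - σ (e.eval υ) ξ)
  have h5 := norm_add_le (τ i c ξ - τ i (e.eval υ) ξ) (τ i (e.eval υ) ξ - σ (e.eval υ) ξ)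
  linarith

/-- The restriction of a ⋆-representation to an invariant subspace. -/
noncomputable def restrictRep {C K : Type*} [NonUnitalCStarAlgebra C] [NormedAddCommGroup K]
    [InnerProductSpace ℂ K] [CompleteSpace K] (τ : C →⋆ₙₐ[ℂ] (K →L[ℂ] K)) (E : Submodule ℂ K)
    [CompleteSpace E] (hE : ∀ c, ∀ x ∈ E, τ c x ∈ E) : C →⋆ₙₐ[ℂ] (E →L[ℂ] E) where
  toFun c := (τ c ∘L E.subtypeL).codRestrict E fun x => hE c x x.2
  map_smul' a c := by
    ext x
    change τ (a • c) x = a • τ c x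
    simp
  map_zero' := by
    ext x
    change τ 0 x = 0
    simp
  map_add' c d := by
    ext x
    change τ (c + d) x = τ c x + τ d x
    simp
  map_mul' c d := by
    ext x
    change τ (c * d) x = τ c (τ d x)
    simp
  map_star' c := by
    rw [ContinuousLinearMap.star_eq_adjoint, ContinuousLinearMap.eq_adjoint_iff]
    intro x y
    change ⟪τ (star c) x, (y : K)⟫_ℂ = ⟪(x : K), τ c y⟫_ℂ
    rw [map_star, ContinuousLinearMap.star_eq_adjoint, ContinuousLinearMap.adjoint_inner_left]

theorem apply_mem_essentialSpace {A C : Type u} [NonUnitalRing A] [Module ℂ A]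
    [MatrixNormed A] [NonUnitalCStarAlgebra C] {υ : A →ₙₐ[ℂ] C} (hυ : IsCStarCover υ)
    {K : Type u} [NormedAddCommGroup K] [InnerProductSpace ℂ K] [CompleteSpace K]
    (τ : C →⋆ₙₐ[ℂ] (K →L[ℂ] K)) (c : C) (ξ : K) :
    τ c ξ ∈ essentialSpace ((τ : C →ₙₐ[ℂ] (K →L[ℂ] K)).comp υ) := by
  refine Submodule.subset_span ⟨τ c, ?_, ξ, rfl⟩
  rw [mem_cstarGenerated_range_iff]
  have hcont : Continuous τ :=
    AddMonoidHomClass.continuous_of_bound τ 1 fun x => by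
      simpa using NonUnitalStarAlgHom.norm_apply_le τ x
  refine map_mem_closure hcont (hυ.mem_closure_range_eval c) ?_
  rintro _ ⟨e, rfl⟩
  exact ⟨e, (StarPoly.map_eval υ τ e).symm⟩

/-- A nonzero element of `C` survives in a term of an approximation of a faithful representation,
and the restriction of that term to its essential space is finite-dimensional. -/
theorem hasSeparatingFinDimReps_of_admitsExelLoringApproximation {A C : Type u} [NonUnitalRing A]
    [Module ℂ A] [MatrixNormed A] [NonUnitalCStarAlgebra C] {υ : A →ₙₐ[ℂ] C}
    (hυ : IsMaximalCStarCover υ) {K : Type u} [NormedAddCommGroup K] [InnerProductSpace ℂ K]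
    [CompleteSpace K] {ρ : C →⋆ₙₐ[ℂ] (K →L[ℂ] K)} (hρ : Function.Injective ρ)
    (h : AdmitsExelLoringApproximation ((ρ : C →ₙₐ[ℂ] (K →L[ℂ] K)).comp υ)) :
    HasSeparatingFinDimReps C := by
  obtain ⟨Λ, _, _, _, π, hπ⟩ := h
  choose τ hτ using fun i => hυ.universal (K →L[ℂ] K) (π i) (hπ.completelyContractive i)
  have hcomp : ∀ i, (τ i : C →ₙₐ[ℂ] (K →L[ℂ] K)).comp υ = π i := fun i => by
    ext1 a; exact hτ i a
  have hlim := tendsto_apply_of_tendsto_generators (τ := τ) (σ := ρ) hυ.toIsCStarCover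
    (fun a ξ => by simp only [hτ]; exact hπ.tendsto a ξ)
    (fun a ξ => by simp only [hτ]; exact hπ.tendsto_adjoint a ξ)
  intro c hc
  obtain ⟨i, hi⟩ : ∃ i, τ i c ≠ 0 := by
    by_contra! hcon
    refine hc ((injective_iff_map_eq_zero ρ).1 hρ c ?_)
    ext ξ
    refine tendsto_nhds_unique (hlim c ξ) ?_
    simp [hcon]
  have hmem : ∀ d ξ, τ i d ξ ∈ essentialSpace (π i) := fun d ξ => by
    rw [← hcomp i]
    exact apply_mem_essentialSpace hυ.toIsCStarCover (τ i) d ξ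
  have hfin := hπ.finiteDimensional i
  have hcomplete : CompleteSpace (essentialSpace (π i)) := FiniteDimensional.complete ℂ _
  refine ⟨essentialSpace (π i), inferInstance, inferInstance, hcomplete, hfin,
    restrictRep (τ i) _ fun d x _ => hmem d x, fun h0 => hi ?_⟩
  -- The range of `τ i (star c)` lies in the essential space, where `τ i c` vanishes.
  rw [← CStarRing.mul_star_self_eq_zero_iff, ← map_star]
  ext ξ
  exact congrArg (fun T => ((T ⟨τ i (star c) ξ, hmem _ ξ⟩ : essentialSpace (π i)) : K)) h0

/-! ### The equivalence -/

theorem theorem3p4 {H : Type u} [NormedAddCommGroup H] [InnerProductSpace ℂ H] [CompleteSpace H]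
    (A : NonUnitalSubalgebra ℂ (H →L[ℂ] H)) (hA : IsClosed (A : Set (H →L[ℂ] H)))
    {C : Type u} [NonUnitalCStarAlgebra C] (υ : A →ₙₐ[ℂ] C) (hυ : IsMaximalCStarCover υ) :
    List.TFAE [
      IsRFD C,
      ∀ (K : Type u) [NormedAddCommGroup K] [InnerProductSpace ℂ K] [CompleteSpace K]
        (π : A →ₙₐ[ℂ] (K →L[ℂ] K)),
        IsCompletelyContractive π → AdmitsExelLoringApproximation π,
      ∀ (K : Type u) [NormedAddCommGroup K] [InnerProductSpace ℂ K] [CompleteSpace K]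
        (ρ : C →⋆ₙₐ[ℂ] (K →L[ℂ] K)), Function.Injective ρ →
        AdmitsExelLoringApproximation ((ρ : C →ₙₐ[ℂ] (K →L[ℂ] K)).comp υ),
      ∃ (K : Type u) (_ : NormedAddCommGroup K) (_ : InnerProductSpace ℂ K) (_ : CompleteSpace K)
        (ρ : C →⋆ₙₐ[ℂ] (K →L[ℂ] K)), Function.Injective ρ ∧
        AdmitsExelLoringApproximation ((ρ : C →ₙₐ[ℂ] (K →L[ℂ] K)).comp υ)] := by
  tfae_have 1 → 2 := by
    intro hC K _ _ _ π hπ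
    obtain ⟨σ, hσ⟩ := hυ.universal (K →L[ℂ] K) π hπ
    have hcomp : (σ : C →ₙₐ[ℂ] (K →L[ℂ] K)).comp υ = π := by ext1 a; exact hσ a
    rw [← hcomp]
    exact admitsExelLoringApproximation_of_separating hυ.completelyIsometric
      hC.hasSeparatingFinDimReps σ
  tfae_have 2 → 3 := fun h K _ _ _ ρ _ =>
    h K _ (IsCompletelyContractive.starAlgHom_comp hυ.completelyIsometric ρ)
  tfae_have 3 → 4 := by
    intro h
    obtain ⟨K, i1, i2, i3, ρ, hρ⟩ := exists_injective_rep C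
    exact ⟨K, i1, i2, i3, ρ, hρ, h K ρ hρ⟩
  tfae_have 4 → 1 := by
    rintro ⟨K, _, _, _, ρ, hρ, h⟩
    exact (hasSeparatingFinDimReps_of_admitsExelLoringApproximation hυ hρ h).isRFD
  tfae_finish
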